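/- Let $\mathbb T^3=(\mathbb R/2\pi\mathbb Z)^3$ carry Lebesgue measure (of total mass $(2\pi)^3$), let $L^{2,\mathrm e}(\mathbb T^3)$ be the Hilbert space of complex-valued square-integrable functions with $f(-p)=f(p)$, and let $L^{2,\mathrm{e,s}}(\mathbb T^3)\subset L^{2,\mathrm e}(\mathbb T^3)$ be the subspace of functions that are symmetric under all permutations of $(p_1,p_2,p_3)$. Put $\mathcal E_0(p)=4\sum_{i=1}^3(1-\cos p_i)$. For $\mu_1,\mu_2\in\mathbb R$ let $H_{\mu_1\mu_2}(0)$ be the bounded self-adjoint operator on $L^{2,\mathrm e}(\mathbb T^3)$ given by $$(H_{\mu_1\mu_2}(0)f)(p)=\mathcal E_0(p)f(p)+\frac{\mu_1}{(2\pi)^3}\int_{\mathbb T^3}f(q)\,dq+\frac{2\mu_2}{(2\pi)^3}\sum_{i=1}^3\cos p_i\int_{\mathbb T^3}\cos q_i\,f(q)\,dq,$$ and let $H^{\mathrm s}_{\mu_1\mu_2}(0)$ be its restriction to the invariant subspace $L^{2,\mathrm{e,s}}(\mathbb T^3)$. Put $$\alpha_1(p)=\frac1{\sqrt{8\pi^3}},\qquad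 \alpha_2(p)=\frac{\cos p_1+\cos p_2+\cos p_3}{\sqrt{12\pi^3}},\qquad a_{1j}(z)=\int_{\mathbb T^3}\frac{\alpha_1(p)\alpha_j(p)}{\mathcal E_0(p)-z}\,dp\quad(j=1,2),$$ $$\mu_0=\frac{24\,a_{11}(0)}{12\,a_{11}(0)-1},\qquad \mu_2^-(\mu_1)=\frac{24}{\mu_1+12}-\mu_0\ (\mu_1\ne-12),\qquad \mu_2^+(\mu_1)=\frac{24}{\mu_1-12}+\mu_0\ (\mu_1\neq 12),$$ and define the regions of the $(\mu_1,\mu_2)$-plane $$\begin{aligned} \mathcal A_0^-&=\{\mu_1>-12,\ \mu_2>\mu_2^-(\mu_1)\},\\ \mathcal A_1^-&=\{\mu_1>-12,\ \mu_2<\mu_2^-(\mu_1)\}\cup\{\mu_1=-12\}\cup\{\mu_1<-12,\ \mu_2>\mu_2^-(\mu_1)\},\\ \mathcal A_2^-&=\{\mu_1<-12,\ \mu_2<\mu_2^-(\mu_1)\},\\ \mathcal A_0^+&=\{\mu_1<12,\ \mu_2<\mu_2^+(\mu_1)\},\\ \mathcal A_1^+&=\{\mu_1<12,\ \mu_2>\mu_2^+(\mu_1)\}\cup\{\mu_1=12\}\cup\{\mu_1>12,\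 \mu_2<\mu_2^+(\mu_1)\},\\ \mathcal A_2^+&=\{\mu_1>12,\ \mu_2>\mu_2^+(\mu_1)\}. \end{aligned}$$ **Theorem.** For all $\mu_1,\mu_2\in\mathbb R$ the operators $H_{\mu_1\mu_2}(0)$ and $H^{\mathrm s}_{\mu_1\mu_2}(0)$ have essential spectrum $[0,24]$. Let $(\mu_1,\mu_2)\in\mathcal A$, where $\mathcal A=\mathcal A^-_\zeta$ (respectively $\mathcal A=\mathcal A^+_\zeta$) for some $\zeta\in\{0,1,2\}$. Then $H^{\mathrm s}_{\mu_1\mu_2}(0)$ has exactly $\zeta$ eigenvalues, counted with multiplicity, below (respectively above) the essential spectrum. In particular, this number is constant throughout $\mathcal A$. For each eigenvalue $z\in\mathbb R\setminus[0,24]$ of $H^{\mathrm s}_{\mu_1\mu_2}(0)$, $\mu_1,\mu_2\in\mathbb R$, the corresponding eigenfunctions are exactly the functions $Cf$, $C\in\mathbb C\setminus\{0\}$, where $$f(p)=\mu_1\mu_2\,a_{12}(z)\,\frac{\alpha_1(p)}{\mathcal E_0(p)-z}-\mu_2\bigl(1+\mu_1a_{11}(z)\bigr)\frac{\alpha_2(p)}{\mathcal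 E_0(p)-z}\quad\text{if }\mu_2\neq0,\qquad f(p)=\frac{\alpha_1(p)}{\mathcal E_0(p)-z}\quad\text{if }\mu_2=0.$$ -/

import Mathlib

open MeasureTheory
open scoped Real ENNReal

noncomputable section

namespace LatticeTwoBoson

instance instFactTwoPiPos : Fact (0 < 2 * π) := ⟨Real.two_pi_pos⟩

/-- The three-dimensional torus `(ℝ / 2πℤ)³`. Its `volume` is the Lebesgue measure, of total
mass `(2π)³`. -/
abbrev Torus3 : Type := Fin 3 → AddCircle (2 * π)

/-- The cosine of a point of `ℝ / 2πℤ`. -/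
def cosC (x : AddCircle (2 * π)) : ℝ := Real.Angle.cos x

/-- The dispersion function `𝓔₀(p) = 4 ∑ᵢ (1 - cos pᵢ)` at zero total quasimomentum. -/
def dispersion (p : Torus3) : ℝ := 4 * ∑ i, (1 - cosC (p i))

/-- The action of the interaction `V_{μ₁μ₂}` on a function `f`. -/
def interactionFun (μ₁ μ₂ : ℝ) (f : Torus3 → ℂ) (p : Torus3) : ℂ :=
  ((μ₁ / (2 * π) ^ 3 : ℝ) : ℂ) * (∫ q, f q) +
    ((2 * μ₂ / (2 * π) ^ 3 : ℝ) : ℂ) *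
      (∑ i, (cosC (p i) : ℂ) * (∫ q : Torus3, (cosC (q i) : ℂ) * f q))

/-- The action of `H_{μ₁μ₂}(0) = H₀(0) + V_{μ₁μ₂}` on a function `f`, where `H₀(0)` is
multiplication by `𝓔₀`. -/
def hamiltonianFun (μ₁ μ₂ : ℝ) (f : Torus3 → ℂ) (p : Torus3) : ℂ :=
  (dispersion p : ℂ) * f p + interactionFun μ₁ μ₂ f p

/-- The Hilbert space `L²(𝕋³)` of complex-valued functions. -/
abbrev L2 : Type := Lp ℂ 2 (volume : Measure Torus3)

theorem continuous_cosC : Continuous cosC := Real.Angle.continuous_cos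

theorem cosC_neg (x : AddCircle (2 * π)) : cosC (-x) = cosC x := Real.Angle.cos_neg x

theorem continuous_dispersion : Continuous dispersion := by
  have h := continuous_cosC
  unfold dispersion
  fun_prop

theorem memLp_bdd_mul {g : Torus3 → ℝ} (hg : Continuous g) {f : Torus3 → ℂ}
    (hf : MemLp f 2 volume) : MemLp (fun p => (g p : ℂ) * f p) 2 volume := by
  obtain ⟨C, hC⟩ := isCompact_univ.exists_bound_of_continuousOn (f := g) hg.continuousOn
  refine MemLp.of_le_mul (c := C) hf ?_ ?_
  · exact ((Complex.continuous_ofReal.comp hg).aestronglyMeasurable).mul hf.1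
  · refine Filter.Eventually.of_forall fun p => ?_
    rw [norm_mul, Complex.norm_real]
    exact mul_le_mul_of_nonneg_right (hC p (Set.mem_univ p)) (norm_nonneg _)

theorem integrable_coe (f : L2) : Integrable (f : Torus3 → ℂ) volume :=
  (Lp.memLp f).integrable (by norm_num)

theorem integrable_cos_mul (f : L2) (i : Fin 3) :
    Integrable (fun q : Torus3 => (cosC (q i) : ℂ) * f q) volume :=
  (memLp_bdd_mul (g := fun q : Torus3 => cosC (q i))
    (continuous_cosC.comp (continuous_apply i)) (Lp.memLp f)).integrable (by norm_num)

theorem continuous_interactionFun (μ₁ μ₂ : ℝ) (f : Torus3 → ℂ) :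
    Continuous (interactionFun μ₁ μ₂ f) := by
  have h := continuous_cosC
  unfold interactionFun
  fun_prop

theorem memLp_hamiltonianFun (μ₁ μ₂ : ℝ) (f : L2) :
    MemLp (hamiltonianFun μ₁ μ₂ f) 2 volume := by
  refine (memLp_bdd_mul continuous_dispersion (Lp.memLp f)).add ?_
  obtain ⟨C, hC⟩ := isCompact_univ.exists_bound_of_continuousOn
    (continuous_interactionFun μ₁ μ₂ f).continuousOn
  exact MemLp.of_bound (continuous_interactionFun μ₁ μ₂ f).aestronglyMeasurable C
    (Filter.Eventually.of_forall fun p => hC p (Set.mem_univ p))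

theorem interactionFun_add (μ₁ μ₂ : ℝ) (f g : L2) (p : Torus3) :
    interactionFun μ₁ μ₂ (f + g : L2) p = interactionFun μ₁ μ₂ f p + interactionFun μ₁ μ₂ g p := by
  have h0 : ∫ q, (f + g : L2) q = (∫ q, f q) + ∫ q, g q := by
    rw [← integral_add (integrable_coe f) (integrable_coe g)]
    exact integral_congr_ae (Lp.coeFn_add f g)
  have h1 : ∀ i : Fin 3, ∫ q : Torus3, (cosC (q i) : ℂ) * (f + g : L2) q =
      (∫ q : Torus3, (cosC (q i) : ℂ) * f q) + ∫ q : Torus3, (cosC (q i) : ℂ) * g q := by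
    intro i
    rw [← integral_add (integrable_cos_mul f i) (integrable_cos_mul g i)]
    refine integral_congr_ae ?_
    filter_upwards [Lp.coeFn_add f g] with q hq
    rw [hq, Pi.add_apply, mul_add]
  unfold interactionFun
  simp only [h0, h1, mul_add, Finset.sum_add_distrib]
  ring

theorem interactionFun_smul (μ₁ μ₂ : ℝ) (c : ℂ) (f : L2) (p : Torus3) :
    interactionFun μ₁ μ₂ (c • f : L2) p = c * interactionFun μ₁ μ₂ f p := by
  have h0 : ∫ q, (c • f : L2) q = c * ∫ q, f q := by
    rw [← integral_const_mul]
    exact integral_congr_ae (Lp.coeFn_smul c f)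
  have h1 : ∀ i : Fin 3, ∫ q : Torus3, (cosC (q i) : ℂ) * (c • f : L2) q =
      c * ∫ q : Torus3, (cosC (q i) : ℂ) * f q := by
    intro i
    rw [← integral_const_mul]
    refine integral_congr_ae ?_
    filter_upwards [Lp.coeFn_smul c f] with q hq
    rw [hq, Pi.smul_apply, smul_eq_mul]
    ring
  unfold interactionFun
  simp only [h0, h1, mul_add, Finset.mul_sum]
  congr 1
  · ring
  · exact Finset.sum_congr rfl fun i _ => by ring

/-- The operator `f ↦ 𝓔₀ f + V_{μ₁μ₂} f` on all of `L²(𝕋³)`. -/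
def hamiltonianL2 (μ₁ μ₂ : ℝ) : L2 →ₗ[ℂ] L2 where
  toFun f := (memLp_hamiltonianFun μ₁ μ₂ f).toLp _
  map_add' f g := by
    rw [← MemLp.toLp_add, MemLp.toLp_eq_toLp_iff]
    filter_upwards [Lp.coeFn_add f g] with p hp
    simp only [hamiltonianFun, Pi.add_apply, interactionFun_add, hp]
    ring
  map_smul' c f := by
    rw [RingHom.id_apply, ← MemLp.toLp_const_smul, MemLp.toLp_eq_toLp_iff]
    filter_upwards [Lp.coeFn_smul c f] with p hp
    simp only [hamiltonianFun, Pi.smul_apply, interactionFun_smul, hp, smul_eq_mul]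
    ring

theorem coeFn_hamiltonianL2 (μ₁ μ₂ : ℝ) (f : L2) :
    (hamiltonianL2 μ₁ μ₂ f : Torus3 → ℂ) =ᵐ[volume] hamiltonianFun μ₁ μ₂ f :=
  MemLp.coeFn_toLp (memLp_hamiltonianFun μ₁ μ₂ f)

/-- The functions invariant under a measure-preserving map `τ` form a linear subspace. -/
theorem invariant_closed (τ : Torus3 → Torus3) (hτ : MeasurePreserving τ volume volume) :
    (∀ f g : L2, (∀ᵐ p, f (τ p) = f p) → (∀ᵐ p, g (τ p) = g p) →
      ∀ᵐ p, (f + g : L2) (τ p) = (f + g : L2) p) ∧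
    (∀ᵐ p, (0 : L2) (τ p) = (0 : L2) p) ∧
    (∀ (c : ℂ) (f : L2), (∀ᵐ p, f (τ p) = f p) → ∀ᵐ p, (c • f : L2) (τ p) = (c • f : L2) p) := by
  refine ⟨fun f g hf hg => ?_, ?_, fun c f hf => ?_⟩
  · filter_upwards [hf, hg, Lp.coeFn_add f g,
      hτ.quasiMeasurePreserving.ae (Lp.coeFn_add f g)] with p h1 h2 h3 h4
    rw [h3, h4, Pi.add_apply, Pi.add_apply, h1, h2]
  · have h := Lp.coeFn_zero ℂ 2 (volume : Measure Torus3)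
    filter_upwards [h, hτ.quasiMeasurePreserving.ae h] with p h3 h4
    rw [h3, h4, Pi.zero_apply, Pi.zero_apply]
  · filter_upwards [hf, Lp.coeFn_smul c f,
      hτ.quasiMeasurePreserving.ae (Lp.coeFn_smul c f)] with p h1 h3 h4
    rw [h3, h4, Pi.smul_apply, Pi.smul_apply, h1]

theorem measurePreserving_neg : MeasurePreserving (fun p : Torus3 => -p) volume volume :=
  volume_preserving_pi (α' := fun _ : Fin 3 => AddCircle (2 * π))
    (β' := fun _ : Fin 3 => AddCircle (2 * π)) (f := fun _ x => -x)
    (fun _ => Measure.measurePreserving_neg (volume : Measure (AddCircle (2 * π))))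

theorem measurePreserving_perm (σ : Equiv.Perm (Fin 3)) :
    MeasurePreserving (fun p : Torus3 => fun i => p (σ i)) volume volume := by
  have h := volume_measurePreserving_piCongrLeft (fun _ : Fin 3 => AddCircle (2 * π)) σ.symm
  convert h using 1
  ext p i
  have := MeasurableEquiv.piCongrLeft_apply_apply (β := fun _ : Fin 3 => AddCircle (2 * π))
    σ.symm p (σ i)
  simpa using this.symm

/-- `L^{2,e}(𝕋³)`: the functions with `f(-p) = f(p)`. -/
def evenL2 : Submodule ℂ L2 where
  carrier := {f | ∀ᵐ p, f (-p) = f p}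
  add_mem' {f g} hf hg := (invariant_closed _ measurePreserving_neg).1 f g hf hg
  zero_mem' := (invariant_closed _ measurePreserving_neg).2.1
  smul_mem' c f hf := (invariant_closed _ measurePreserving_neg).2.2 c f hf

/-- `L^{2,e,s}(𝕋³)`: the even functions symmetric under all permutations of `(p₁, p₂, p₃)`. -/
def evenSymL2 : Submodule ℂ L2 where
  carrier := {f | f ∈ evenL2 ∧
    ∀ σ : Equiv.Perm (Fin 3), ∀ᵐ p : Torus3, f (fun i => p (σ i)) = f p}
  add_mem' {f g} hf hg := ⟨add_mem hf.1 hg.1, fun σ =>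
    (invariant_closed _ (measurePreserving_perm σ)).1 f g (hf.2 σ) (hg.2 σ)⟩
  zero_mem' := ⟨zero_mem _, fun σ => (invariant_closed _ (measurePreserving_perm σ)).2.1⟩
  smul_mem' c f hf := ⟨Submodule.smul_mem _ c hf.1, fun σ =>
    (invariant_closed _ (measurePreserving_perm σ)).2.2 c f (hf.2 σ)⟩

theorem hamiltonianL2_mem_evenL2 (μ₁ μ₂ : ℝ) (f : L2) (hf : f ∈ evenL2) :
    hamiltonianL2 μ₁ μ₂ f ∈ evenL2 := by
  have h := coeFn_hamiltonianL2 μ₁ μ₂ f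
  have hf' : ∀ᵐ p, f (-p) = f p := hf
  change ∀ᵐ p, hamiltonianL2 μ₁ μ₂ f (-p) = hamiltonianL2 μ₁ μ₂ f p
  filter_upwards [hf', h, measurePreserving_neg.quasiMeasurePreserving.ae h] with p h1 h2 h3
  rw [h2, h3]
  simp only [hamiltonianFun, interactionFun, dispersion, Pi.neg_apply, cosC_neg, h1]

theorem hamiltonianL2_mem_evenSymL2 (μ₁ μ₂ : ℝ) (f : L2) (hf : f ∈ evenSymL2) :
    hamiltonianL2 μ₁ μ₂ f ∈ evenSymL2 := by
  refine ⟨hamiltonianL2_mem_evenL2 μ₁ μ₂ f hf.1, fun σ => ?_⟩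
  have h := coeFn_hamiltonianL2 μ₁ μ₂ f
  have hI : ∀ i : Fin 3, ∫ q : Torus3, (cosC (q (σ i)) : ℂ) * f q =
      ∫ q : Torus3, (cosC (q i) : ℂ) * f q := by
    intro i
    have hm := measurePreserving_perm σ
    have e : ∀ g : Torus3 → ℂ, AEStronglyMeasurable g volume →
        ∫ q, g q = ∫ q : Torus3, g (fun j => q (σ j)) := by
      intro g hg
      rw [← hm.map_eq] at hg
      have e := integral_map hm.measurable.aemeasurable hg
      rwa [hm.map_eq] at e
    rw [e _ (integrable_cos_mul f i).aestronglyMeasurable]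
    refine integral_congr_ae ?_
    filter_upwards [hf.2 σ] with q hq
    simp only [hq]
  filter_upwards [hf.2 σ, h,
    (measurePreserving_perm σ).quasiMeasurePreserving.ae h] with p h1 h2 h3
  rw [h2, h3]
  have hE : dispersion (fun i => p (σ i)) = dispersion p := by
    unfold dispersion
    rw [Equiv.sum_comp σ (fun i => 1 - cosC (p i))]
  have hV : interactionFun μ₁ μ₂ f (fun i => p (σ i)) = interactionFun μ₁ μ₂ f p := by
    unfold interactionFun
    rw [← Equiv.sum_comp σ (fun i => (cosC (p i) : ℂ) * ∫ q : Torus3, (cosC (q i) : ℂ) * f q)]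
    simp only [hI]
  simp only [hamiltonianFun, hE, hV, h1]

/-- The lattice Schrödinger operator `H_{μ₁μ₂}(0)` on `L^{2,e}(𝕋³)`. -/
def hamiltonian (μ₁ μ₂ : ℝ) : Module.End ℂ evenL2 :=
  (hamiltonianL2 μ₁ μ₂).restrict (hamiltonianL2_mem_evenL2 μ₁ μ₂)

/-- The restriction `Hˢ_{μ₁μ₂}(0)` of `H_{μ₁μ₂}(0)` to `L^{2,e,s}(𝕋³)`. -/
def hamiltonianSym (μ₁ μ₂ : ℝ) : Module.End ℂ evenSymL2 :=
  (hamiltonianL2 μ₁ μ₂).restrict (hamiltonianL2_mem_evenSymL2 μ₁ μ₂)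

/-- The essential spectrum of an everywhere defined self-adjoint operator: the real numbers `z`
that admit a singular Weyl sequence, i.e. unit vectors `uₙ` tending weakly to `0` with
`‖(T - z) uₙ‖ → 0`. -/
def essentialSpectrum {E : Type*} [NormedAddCommGroup E] [InnerProductSpace ℂ E]
    (T : Module.End ℂ E) : Set ℝ :=
  {z | ∃ u : ℕ → E, (∀ n, ‖u n‖ = 1) ∧
    (∀ v : E, Filter.Tendsto (fun n => inner ℂ v (u n)) Filter.atTop (nhds 0)) ∧
    Filter.Tendsto (fun n => ‖T (u n) - (z : ℂ) • u n‖) Filter.atTop (nhds 0)}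

/-- The number of eigenvalues of `T` in `S ⊆ ℝ`, counted with multiplicity: the sum over `z ∈ S`,
in `ℕ ∪ {∞}`, of the dimensions of the eigenspaces `ker (T - z)`. -/
def eigenvalueCount {E : Type*} [AddCommGroup E] [Module ℂ E]
    (T : Module.End ℂ E) (S : Set ℝ) : ℕ∞ :=
  ⨆ (s : Finset ℝ) (_ : (s : Set ℝ) ⊆ S),
    ∑ z ∈ s, Cardinal.toENat (Module.rank ℂ (Module.End.eigenspace T (z : ℂ)))

/-- The real numbers strictly below the set `S`. -/
def below (S : Set ℝ) : Set ℝ := {z | ∀ w ∈ S, z < w}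

/-- The real numbers strictly above the set `S`. -/
def above (S : Set ℝ) : Set ℝ := {z | ∀ w ∈ S, w < z}

/-- `α₁ˢ(p) = 1 / √(8π³)`. -/
def alpha₁ (_p : Torus3) : ℝ := 1 / √(8 * π ^ 3)

/-- `α₂ˢ(p) = (cos p₁ + cos p₂ + cos p₃) / √(12π³)`. -/
def alpha₂ (p : Torus3) : ℝ := (∑ i, cosC (p i)) / √(12 * π ^ 3)

/-- `a₁₁ˢ(z) = ∫ α₁ˢ(p)² / (𝓔₀(p) - z) dp`. -/
def a₁₁ (z : ℝ) : ℝ := ∫ p : Torus3, alpha₁ p * alpha₁ p / (dispersion p - z)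

/-- `a₁₂ˢ(z) = ∫ α₁ˢ(p) α₂ˢ(p) / (𝓔₀(p) - z) dp`. -/
def a₁₂ (z : ℝ) : ℝ := ∫ p : Torus3, alpha₁ p * alpha₂ p / (dispersion p - z)

/-- `μ₀ = 24 a₁₁ˢ(0) / (12 a₁₁ˢ(0) - 1)`. -/
def mu₀ : ℝ := 24 * a₁₁ 0 / (12 * a₁₁ 0 - 1)

/-- `μ₂⁻(μ₁) = 24 / (μ₁ + 12) - μ₀`, used for `μ₁ ≠ -12` only. -/
def curveMinus (μ₁ : ℝ) : ℝ := 24 / (μ₁ + 12) - mu₀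

/-- `μ₂⁺(μ₁) = 24 / (μ₁ - 12) + μ₀`, used for `μ₁ ≠ 12` only. -/
def curvePlus (μ₁ : ℝ) : ℝ := 24 / (μ₁ - 12) + mu₀

/-- The regions `𝒜⁻_ζ`, `ζ = 0, 1, 2`. -/
def regionMinus : Fin 3 → Set (ℝ × ℝ) :=
  ![{m | -12 < m.1 ∧ curveMinus m.1 < m.2},
    {m | -12 < m.1 ∧ m.2 < curveMinus m.1} ∪ {m | m.1 = -12} ∪
      {m | m.1 < -12 ∧ curveMinus m.1 < m.2},
    {m | m.1 < -12 ∧ m.2 < curveMinus m.1}]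

/-- The regions `𝒜⁺_ζ`, `ζ = 0, 1, 2`. -/
def regionPlus : Fin 3 → Set (ℝ × ℝ) :=
  ![{m | m.1 < 12 ∧ m.2 < curvePlus m.1},
    {m | m.1 < 12 ∧ curvePlus m.1 < m.2} ∪ {m | m.1 = 12} ∪
      {m | 12 < m.1 ∧ m.2 < curvePlus m.1},
    {m | 12 < m.1 ∧ curvePlus m.1 < m.2}]

/-- The number of eigenvalues of `Hˢ_{μ₁μ₂}(0)` below the essential spectrum of `H_{μ₁μ₂}(0)`. -/
def countBelow (μ₁ μ₂ : ℝ) : ℕ∞ :=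
  eigenvalueCount (hamiltonianSym μ₁ μ₂) (below (essentialSpectrum (hamiltonian μ₁ μ₂)))

/-- The number of eigenvalues of `Hˢ_{μ₁μ₂}(0)` above the essential spectrum of `H_{μ₁μ₂}(0)`. -/
def countAbove (μ₁ μ₂ : ℝ) : ℕ∞ :=
  eigenvalueCount (hamiltonianSym μ₁ μ₂) (above (essentialSpectrum (hamiltonian μ₁ μ₂)))

/-- The function `p ↦ μ₁μ₂ a₁₂ˢ(z) α₁ˢ(p) / (𝓔₀(p) - z) - μ₂ (1 + μ₁ a₁₁ˢ(z)) α₂ˢ(p) / (𝓔₀(p) - z)`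
if `μ₂ ≠ 0`. For `μ₂ = 0` this expression vanishes identically, and the function is
`p ↦ α₁ˢ(p) / (𝓔₀(p) - z)` instead. -/
def eigenfunctionForm (μ₁ μ₂ z : ℝ) (p : Torus3) : ℝ :=
  if μ₂ = 0 then alpha₁ p / (dispersion p - z)
  else μ₁ * μ₂ * a₁₂ z * (alpha₁ p / (dispersion p - z)) -
    μ₂ * (1 + μ₁ * a₁₁ z) * (alpha₂ p / (dispersion p - z))

/-- The eigenfunctions of `Hˢ_{μ₁μ₂}(0)` for `z` are exactly the nonzero multiples of
`eigenfunctionForm μ₁ μ₂ z`. -/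
def HasEigenfunctionForm (μ₁ μ₂ z : ℝ) : Prop :=
  ∀ f : evenSymL2, Module.End.HasEigenvector (hamiltonianSym μ₁ μ₂) (z : ℂ) f ↔
    ∃ C : ℂ, C ≠ 0 ∧
      ((f : L2) : Torus3 → ℂ) =ᵐ[volume] fun p => C * (eigenfunctionForm μ₁ μ₂ z p : ℂ)

end LatticeTwoBoson

end

/-!
On the symmetric subspace the interaction is `μ₁ α₁ ⟨α₁, ·⟩ + μ₂ α₂ ⟨α₂, ·⟩`. A vector `f` with
`(Hˢ - z) f = 0`, `z ∉ [0, 24]`, is therefore a combination of the two functions `αᵢ / (𝓔₀ - z)`,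
and its coefficients solve a homogeneous `2 × 2` system with determinant `Δ(z)`. The off-diagonal
entry `a₁₂(z)` never vanishes, so the eigenvalues are exactly the zeros of `Δ`, all simple, and the
eigenvectors have the stated form (`eigenvector_form`, `exists_eigenvector`, `rank_eigenspace`).

Since `(12 - 𝓔₀) α₁ = 2√6 α₂`, every matrix element is a function of `a = a₁₁(z)` and
`w = 12 - z`, and for `z < 0` the equation `Δ(z) = 0` becomes
`(w + μ₁) (m(w) + μ₂) = 24` with `m = 24 a / (w a - 1)` and `m(12) = μ₀`
(`fredholmDet_neg_eq_zero_iff`). Here `m` is nondecreasing, because `(𝓔₀ - y)⁻¹` and `(𝓔₀ - z)⁻¹`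
are positively correlated (`a₁₁_correlation`), it is continuous up to the threshold `w = 12`,
because `1 / 𝓔₀` is integrable in dimension three (`integrable_inv_dispersion`), and it tends to
infinity. A product of two increasing factors takes the value `24` at most once where both are
positive and at most once where both are negative; which of the two solutions lie in `w > 12` is
decided by the signs of `12 + μ₁` and `(12 + μ₁) (μ₀ + μ₂) - 24` (`mul_eq_solutions`), and these
are what the regions `𝒜⁻` record. Translation by `(π, π, π)` reduces the eigenvalues above `24` to
those below `0`, with `(μ₁, μ₂)` replaced by `(-μ₁, -μ₂)` (`fredholmDet_reflect`).

The essential spectrum is the range `[0, 24]` of `𝓔₀`. Normalised indicators of level shells of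
`𝓔₀` are even, symmetric and orthonormal, and serve as Weyl sequences; the interaction, being of
finite rank, tends to `0` along weakly null sequences.
-/

noncomputable section

namespace LatticeTwoBoson

/-! ### Cosines and the dispersion function, and integrability of `1 / 𝓔₀` -/

/-- The function `∑ᵢ cos pᵢ` on the torus. -/
def cosSum (p : Torus3) : ℝ := ∑ i, cosC (p i)

theorem continuous_cosSum : Continuous cosSum := by
  have h := continuous_cosC
  unfold cosSum
  fun_prop

theorem dispersion_eq (p : Torus3) : dispersion p = 12 - 4 * cosSum p := by
  simp only [dispersion, cosSum, Fin.sum_univ_three]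
  ring

theorem cosC_coe (x : ℝ) : cosC (x : AddCircle (2 * π)) = Real.cos x := Real.Angle.cos_coe x

theorem cosC_mem_Icc (x : AddCircle (2 * π)) : cosC x ∈ Set.Icc (-1 : ℝ) 1 := by
  induction x using QuotientAddGroup.induction_on with
  | H x => exact ⟨(Real.neg_one_le_cos x).trans_eq (cosC_coe x).symm,
      (cosC_coe x).trans_le (Real.cos_le_one x)⟩

theorem cosC_add_pi (x : AddCircle (2 * π)) : cosC (x + ((π : ℝ) : AddCircle (2 * π))) = -cosC x :=
  Real.Angle.cos_add_pi x

theorem cosC_zero : cosC 0 = 1 := Real.Angle.cos_zero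

theorem cosC_eq_one {x : AddCircle (2 * π)} (h : cosC x = 1) : x = 0 := by
  induction x using QuotientAddGroup.induction_on with
  | H x =>
    have h1 : Real.cos x = Real.cos 0 := by
      rw [Real.cos_zero]
      exact (cosC_coe x).symm.trans h
    rcases Real.Angle.cos_eq_iff_coe_eq_or_eq_neg.1 h1 with h2 | h2
    · exact h2
    · rw [Real.Angle.coe_zero, neg_zero] at h2
      exact h2

theorem dispersion_mem_Icc (p : Torus3) : dispersion p ∈ Set.Icc (0 : ℝ) 24 := by
  have h := fun i => cosC_mem_Icc (p i)
  simp only [dispersion, Fin.sum_univ_three]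
  constructor <;> linarith [(h 0).1, (h 0).2, (h 1).1, (h 1).2, (h 2).1, (h 2).2]

theorem dispersion_zero : dispersion 0 = 0 := by
  simp [dispersion, cosC_zero]

theorem dispersion_eq_zero_iff (p : Torus3) : dispersion p = 0 ↔ p = 0 := by
  refine ⟨fun h => ?_, fun h => h ▸ dispersion_zero⟩
  have hp := fun i => cosC_mem_Icc (p i)
  simp only [dispersion, Fin.sum_univ_three] at h
  ext i
  refine cosC_eq_one ?_
  fin_cases i <;> simp only [Fin.zero_eta, Fin.mk_one, Fin.reduceFinMk] <;>
    linarith [(hp 0).2, (hp 1).2, (hp 2).2]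

theorem ae_ne_zero : ∀ᵐ p : Torus3, ∀ i, p i ≠ 0 := by
  have h0 : ∀ x : AddCircle (2 * π), volume ({x} : Set (AddCircle (2 * π))) = 0 := fun x => by
    have h := AddCircle.volume_closedBall (2 * π) (x := x) 0
    simpa [Real.two_pi_pos.le] using h
  have : NullSingletonClass (volume : Measure (AddCircle (2 * π))) := ⟨h0⟩
  refine ae_all_iff.2 fun i => ?_
  rw [ae_iff]
  simp only [ne_eq, not_not]
  exact Measure.pi_hyperplane (fun _ : Fin 3 => (volume : Measure (AddCircle (2 * π)))) i 0

theorem ae_dispersion_pos : ∀ᵐ p : Torus3, 0 < dispersion p := by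
  filter_upwards [ae_ne_zero] with p hp
  refine lt_of_le_of_ne (dispersion_mem_Icc p).1 fun h => hp 0 ?_
  rw [(dispersion_eq_zero_iff p).1 h.symm, Pi.zero_apply]

theorem dispersion_sub_ne_zero {z : ℝ} (hz : z ∉ Set.Icc (0 : ℝ) 24) (p : Torus3) :
    dispersion p - z ≠ 0 := fun h => hz (sub_eq_zero.1 h ▸ dispersion_mem_Icc p)

/-- The point `(π, π, π)`. Translation by it turns `𝓔₀` into `24 - 𝓔₀`, and so exchanges the two
edges of the essential spectrum. -/
def halfShift : Torus3 := fun _ => ((π : ℝ) : AddCircle (2 * π))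

theorem cosSum_add_halfShift (p : Torus3) : cosSum (p + halfShift) = -cosSum p := by
  simp only [cosSum, Pi.add_apply, halfShift, cosC_add_pi, Finset.sum_neg_distrib]

theorem dispersion_add_halfShift (p : Torus3) :
    dispersion (p + halfShift) = 24 - dispersion p := by
  rw [dispersion_eq, dispersion_eq, cosSum_add_halfShift]
  ring

/-- The singularity of `(1 - cos x)^(-1/3)` at `0` is of order `|x|^(-2/3)`, hence integrable. -/
theorem integrable_one_sub_cosC_rpow :
    Integrable (fun x : AddCircle (2 * π) => (1 - cosC x) ^ (-(1 / 3) : ℝ)) volume := by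
  have hmeas : Measurable fun x : AddCircle (2 * π) => (1 - cosC x) ^ (-(1 / 3) : ℝ) :=
    (measurable_const.sub continuous_cosC.measurable).pow_const _
  rw [← (AddCircle.measurePreserving_mk (2 * π) (-π)).integrable_comp hmeas.aestronglyMeasurable]
  have hdom : IntegrableOn
      (fun x : ℝ => (2 / π ^ 2) ^ (-(1 / 3) : ℝ) * |x| ^ (-(2 / 3) : ℝ))
      (Set.Ioc (-π) (-π + 2 * π)) := by
    refine Integrable.const_mul ?_ _
    have e : -π + 2 * π = π := by ring
    rw [e]
    have h1 : IntegrableOn (fun x : ℝ => |x| ^ (-(2 / 3) : ℝ)) (Set.Ioc 0 π) := by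
      have h := (intervalIntegrable_iff_integrableOn_Ioc_of_le Real.pi_pos.le).1
        (intervalIntegral.intervalIntegrable_rpow' (a := 0) (b := π) (r := -(2 / 3)) (by norm_num))
      refine h.congr_fun (fun x hx => ?_) measurableSet_Ioc
      simp only [abs_of_pos hx.1]
    have h2 : IntegrableOn (fun x : ℝ => |x| ^ (-(2 / 3) : ℝ)) (Set.Ioc (-π) 0) := by
      have h3 : IntervalIntegrable (fun x : ℝ => |x| ^ (-(2 / 3) : ℝ)) volume 0 π :=
        (intervalIntegrable_iff_integrableOn_Ioc_of_le Real.pi_pos.le).2 h1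
      have h4 := (IntervalIntegrable.iff_comp_neg (f := fun x : ℝ => |x| ^ (-(2 / 3) : ℝ))).1 h3
      simp only [abs_neg, neg_zero] at h4
      exact (intervalIntegrable_iff_integrableOn_Ioc_of_le (by linarith [Real.pi_pos])).1 h4.symm
    have h5 := h2.union h1
    rwa [Set.Ioc_union_Ioc_eq_Ioc (by linarith [Real.pi_pos]) Real.pi_pos.le] at h5
  refine Integrable.mono' hdom (hmeas.comp measurable_quotient_mk'').aestronglyMeasurable ?_
  have hne : ∀ᵐ x : ℝ ∂volume.restrict (Set.Ioc (-π) (-π + 2 * π)), x ≠ 0 :=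
    ae_restrict_of_ae (by simp [ae_iff])
  filter_upwards [hne, ae_restrict_mem measurableSet_Ioc] with x hx0 hx
  have hle : |x| ≤ π := abs_le.2 ⟨hx.1.le, by linarith [hx.2]⟩
  have hcos : 2 / π ^ 2 * |x| ^ 2 ≤ 1 - Real.cos x := by
    have := Real.cos_le_one_sub_mul_cos_sq hle
    rw [sq_abs]
    linarith
  have hpos : 0 < 2 / π ^ 2 * |x| ^ 2 := by positivity
  have hval : ((fun x : AddCircle (2 * π) => (1 - cosC x) ^ (-(1 / 3) : ℝ)) ∘
      (QuotientAddGroup.mk : ℝ → AddCircle (2 * π))) x = (1 - Real.cos x) ^ (-(1 / 3) : ℝ) := by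
    change (1 - cosC (x : AddCircle (2 * π))) ^ (-(1 / 3) : ℝ) = _
    rw [cosC_coe]
  rw [hval, Real.norm_of_nonneg (Real.rpow_nonneg (hpos.le.trans hcos) _)]
  calc (1 - Real.cos x) ^ (-(1 / 3) : ℝ) ≤ (2 / π ^ 2 * |x| ^ 2) ^ (-(1 / 3) : ℝ) :=
        Real.rpow_le_rpow_of_nonpos hpos hcos (by norm_num)
    _ = _ := by
        rw [Real.mul_rpow (by positivity) (by positivity), ← Real.rpow_natCast |x| 2,
          ← Real.rpow_mul (abs_nonneg x)]
        norm_num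

/-- `1 / 𝓔₀` is integrable on the three-dimensional torus: by the inequality of arithmetic and
geometric means it is at most `∏ᵢ (1 - cos pᵢ)^(-1/3)`, up to a constant, and this is a product of
integrable functions of one variable. -/
theorem integrable_inv_dispersion : Integrable (fun p : Torus3 => (dispersion p)⁻¹) volume := by
  have hprod : Integrable (fun p : Torus3 => ∏ i, (1 - cosC (p i)) ^ (-(1 / 3) : ℝ)) volume :=
    Integrable.fintype_prod fun _ => integrable_one_sub_cosC_rpow
  refine hprod.mono' continuous_dispersion.measurable.inv.aestronglyMeasurable
    ?_
  filter_upwards [ae_ne_zero] with p hp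
  have h0 : ∀ i, 0 < 1 - cosC (p i) := fun i =>
    sub_pos.2 (lt_of_le_of_ne (cosC_mem_Icc (p i)).2 fun h => hp i (cosC_eq_one h))
  rw [Real.norm_of_nonneg (inv_nonneg.2 (dispersion_mem_Icc p).1)]
  have hamgm := Real.geom_mean_le_arith_mean3_weighted (w₁ := 1 / 3) (w₂ := 1 / 3) (w₃ := 1 / 3)
    (by norm_num) (by norm_num) (by norm_num) (h0 0).le (h0 1).le (h0 2).le (by norm_num)
  simp only [Fin.prod_univ_three, Real.rpow_neg (h0 _).le, ← mul_inv]
  have hpow : ∀ i, 0 < (1 - cosC (p i)) ^ (1 / 3 : ℝ) := fun i => Real.rpow_pos_of_pos (h0 i) _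
  refine inv_anti₀ (mul_pos (mul_pos (hpow 0) (hpow 1)) (hpow 2)) (hamgm.trans ?_)
  simp only [dispersion, Fin.sum_univ_three]
  linarith [h0 0, h0 1, h0 2]

/-! ### The Stieltjes transform of the dispersion function -/

/-- Lebesgue measure on the torus, normalised to total mass `1`. -/
def torusProb : Measure Torus3 := ENNReal.ofReal (1 / (8 * π ^ 3)) • volume

theorem alpha₁_mul_alpha₁ (p : Torus3) : alpha₁ p * alpha₁ p = 1 / (8 * π ^ 3) := by
  have h : (0 : ℝ) ≤ 8 * π ^ 3 := by positivity
  rw [alpha₁, div_mul_div_comm, one_mul, Real.mul_self_sqrt h]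

instance isProbabilityMeasure_torusProb : IsProbabilityMeasure torusProb := by
  refine ⟨?_⟩
  have h : (volume : Measure Torus3) Set.univ = ENNReal.ofReal (8 * π ^ 3) := by
    rw [volume_pi, Measure.pi_univ]
    simp only [AddCircle.measure_univ, Finset.prod_const, Finset.card_univ, Fintype.card_fin]
    rw [← ENNReal.ofReal_pow (by positivity)]
    congr 1
    ring
  have hpos : (0 : ℝ) < 8 * π ^ 3 := by positivity
  rw [torusProb, Measure.smul_apply, h, smul_eq_mul, ← ENNReal.ofReal_mul (by positivity),
    one_div_mul_cancel hpos.ne', ENNReal.ofReal_one]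

theorem integral_torusProb (f : Torus3 → ℝ) :
    ∫ p, f p ∂torusProb = 1 / (8 * π ^ 3) * ∫ p, f p := by
  rw [torusProb, integral_smul_measure, ENNReal.toReal_ofReal (by positivity), smul_eq_mul]

theorem ae_torusProb {P : Torus3 → Prop} (h : ∀ᵐ p : Torus3, P p) : ∀ᵐ p ∂torusProb, P p :=
  Measure.ae_smul_measure h _

theorem integrable_torusProb {f : Torus3 → ℝ} (h : Integrable f volume) : Integrable f torusProb :=
  h.smul_measure ENNReal.ofReal_ne_top

theorem integrable_of_continuous {f : Torus3 → ℝ} (h : Continuous f) : Integrable f torusProb :=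
  integrable_torusProb (h.integrable_of_hasCompactSupport (HasCompactSupport.of_compactSpace f))

theorem integral_torusProb_add_halfShift (f : Torus3 → ℝ) :
    ∫ p, f (p + halfShift) ∂torusProb = ∫ p, f p ∂torusProb := by
  rw [integral_torusProb, integral_torusProb, integral_add_right_eq_self]

theorem integral_dispersion : ∫ p, dispersion p ∂torusProb = 12 := by
  have h := integral_torusProb_add_halfShift dispersion
  simp only [dispersion_add_halfShift] at h
  rw [integral_sub (integrable_const _) (integrable_of_continuous continuous_dispersion),
    integral_const, probReal_univ, one_smul] at h
  linarith

theorem continuous_inv_dispersion_sub {z : ℝ} (hz : z ∉ Set.Icc (0 : ℝ) 24) :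
    Continuous fun p => (dispersion p - z)⁻¹ :=
  (continuous_dispersion.sub continuous_const).inv₀ (dispersion_sub_ne_zero hz)

theorem integrable_inv_dispersion_sub {z : ℝ} (hz : z ≤ 0) :
    Integrable (fun p => (dispersion p - z)⁻¹) torusProb := by
  rcases hz.eq_or_lt with rfl | h
  · simpa only [sub_zero] using integrable_torusProb integrable_inv_dispersion
  · exact integrable_of_continuous (continuous_inv_dispersion_sub fun h' => h.not_ge h'.1)

theorem a₁₁_eq (z : ℝ) : a₁₁ z = ∫ p, (dispersion p - z)⁻¹ ∂torusProb := by
  rw [a₁₁, integral_torusProb, ← integral_const_mul]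
  simp only [alpha₁_mul_alpha₁, div_eq_mul_inv]

theorem a₁₁_reflect (z : ℝ) : a₁₁ (24 - z) = -a₁₁ z := by
  rw [a₁₁_eq, a₁₁_eq, ← integral_torusProb_add_halfShift, ← integral_neg]
  congr 1
  ext p
  rw [dispersion_add_halfShift, ← inv_neg]
  congr 1
  ring

theorem le_a₁₁ {z : ℝ} (hz : z ≤ 0) : (24 - z)⁻¹ ≤ a₁₁ z := by
  rw [a₁₁_eq]
  have h : ∫ _p : Torus3, (24 - z)⁻¹ ∂torusProb = (24 - z)⁻¹ := by
    rw [integral_const, probReal_univ, one_smul]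
  rw [← h]
  refine integral_mono_ae (integrable_const _) (integrable_inv_dispersion_sub hz) ?_
  filter_upwards [ae_torusProb ae_dispersion_pos] with p hp
  exact inv_anti₀ (by linarith) (by linarith [(dispersion_mem_Icc p).2])

theorem a₁₁_pos {z : ℝ} (hz : z ≤ 0) : 0 < a₁₁ z :=
  (inv_pos.2 (by linarith)).trans_le (le_a₁₁ hz)

/-- The variance of `𝓔₀` under the normalised Lebesgue measure. -/
def dispersionVariance : ℝ := ∫ p, (12 - dispersion p) ^ 2 ∂torusProb

theorem dispersionVariance_pos : 0 < dispersionVariance := by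
  rw [dispersionVariance, integral_torusProb]
  have hc : Continuous fun p => (12 - dispersion p) ^ 2 :=
    (continuous_const.sub continuous_dispersion).pow 2
  refine mul_pos (by positivity) (hc.integral_pos_of_hasCompactSupport_nonneg_nonzero (x := 0)
    (HasCompactSupport.of_compactSpace _) (fun p => sq_nonneg _) ?_)
  norm_num [dispersion_zero]

/-- Since the mean of `𝓔₀` is `12`, the first-order term of `(12 - z) / (𝓔₀ - z)` around the mean
integrates to `0` and a second-order remainder is left. -/
theorem sub_mul_a₁₁_sub_one {z : ℝ} (hz : z ≤ 0) :
    (12 - z) * a₁₁ z - 1 =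
      ∫ p, (12 - dispersion p) ^ 2 * ((12 - z)⁻¹ * (dispersion p - z)⁻¹) ∂torusProb := by
  have h0 : 12 - z ≠ 0 := by linarith
  have h1 : ∀ᵐ p ∂torusProb,
      (12 - dispersion p) ^ 2 * ((12 - z)⁻¹ * (dispersion p - z)⁻¹) =
        (12 - z) * (dispersion p - z)⁻¹ - (1 + (12 - z)⁻¹ * (12 - dispersion p)) := by
    filter_upwards [ae_torusProb ae_dispersion_pos] with p hp
    have h2 : dispersion p - z ≠ 0 := by linarith
    field_simp
    ring
  have h3 : Integrable (fun p => 12 - dispersion p) torusProb :=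
    integrable_of_continuous (continuous_const.sub continuous_dispersion)
  have h4 : Integrable (fun p => 1 + (12 - z)⁻¹ * (12 - dispersion p)) torusProb :=
    (integrable_const _).add (h3.const_mul _)
  rw [integral_congr_ae h1, integral_sub ((integrable_inv_dispersion_sub hz).const_mul _) h4,
    integral_add (integrable_const _) (h3.const_mul _), integral_const_mul,
    integral_const_mul, integral_sub (integrable_const _)
    (integrable_of_continuous continuous_dispersion), integral_dispersion, a₁₁_eq]
  simp

theorem integrable_second_order {z : ℝ} (hz : z ≤ 0) :
    Integrable (fun p => (12 - dispersion p) ^ 2 * ((12 - z)⁻¹ * (dispersion p - z)⁻¹))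
      torusProb := by
  refine ((integrable_inv_dispersion_sub hz).const_mul (12 - z)⁻¹).bdd_mul (c := 144)
    ((continuous_const.sub continuous_dispersion).pow 2).aestronglyMeasurable
    (Filter.Eventually.of_forall fun p => ?_)
  rw [Real.norm_of_nonneg (sq_nonneg _)]
  nlinarith [(dispersion_mem_Icc p).1, (dispersion_mem_Icc p).2]

theorem sub_mul_a₁₁_sub_one_pos {z : ℝ} (hz : z ≤ 0) : 0 < (12 - z) * a₁₁ z - 1 := by
  have hc : 0 < (12 - z)⁻¹ * (24 - z)⁻¹ :=
    mul_pos (inv_pos.2 (by linarith)) (inv_pos.2 (by linarith))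
  refine (mul_pos dispersionVariance_pos hc).trans_le ?_
  rw [sub_mul_a₁₁_sub_one hz, dispersionVariance, ← integral_mul_const]
  have hcont : Continuous fun p => (12 - dispersion p) ^ 2 * ((12 - z)⁻¹ * (24 - z)⁻¹) := by
    have := continuous_dispersion
    fun_prop
  refine integral_mono_ae (integrable_of_continuous hcont) (integrable_second_order hz) ?_
  filter_upwards [ae_torusProb ae_dispersion_pos] with p hp
  refine mul_le_mul_of_nonneg_left (mul_le_mul_of_nonneg_left ?_ (inv_nonneg.2 (by linarith)))
    (sq_nonneg _)
  exact inv_anti₀ (by linarith) (by linarith [(dispersion_mem_Icc p).2])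

theorem sub_mul_a₁₁_sub_one_le {z : ℝ} (hz : z < 0) :
    (12 - z) * a₁₁ z - 1 ≤ 144 * ((12 - z)⁻¹ * (-z)⁻¹) := by
  have h : ∫ _p : Torus3, 144 * ((12 - z)⁻¹ * (-z)⁻¹) ∂torusProb =
      144 * ((12 - z)⁻¹ * (-z)⁻¹) := by
    rw [integral_const, probReal_univ, one_smul]
  rw [sub_mul_a₁₁_sub_one hz.le, ← h]
  refine integral_mono (integrable_second_order hz.le) (integrable_const _) fun p => ?_
  have hp := dispersion_mem_Icc p
  have h1 : (dispersion p - z)⁻¹ ≤ (-z)⁻¹ := inv_anti₀ (by linarith) (by linarith [hp.1])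
  have h2 : 0 < (dispersion p - z)⁻¹ := inv_pos.2 (by linarith [hp.1])
  have h3 : 0 < (12 - z)⁻¹ := inv_pos.2 (by linarith)
  refine mul_le_mul ?_ (mul_le_mul_of_nonneg_left h1 h3.le) (mul_pos h3 h2).le (by norm_num)
  nlinarith [hp.1, hp.2]

theorem sub_mul_a₁₁_reflect (z : ℝ) : (12 - (24 - z)) * a₁₁ (24 - z) = (12 - z) * a₁₁ z := by
  rw [a₁₁_reflect]
  ring

theorem continuousOn_a₁₁ : ContinuousOn a₁₁ (Set.Iic 0) := by
  have e : a₁₁ = fun z => ∫ p, (dispersion p - z)⁻¹ ∂torusProb := funext a₁₁_eq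
  rw [e]
  refine continuousOn_of_dominated (bound := fun p => (dispersion p)⁻¹)
    (fun z hz => (integrable_inv_dispersion_sub hz).aestronglyMeasurable) (fun z hz => ?_)
    (integrable_torusProb integrable_inv_dispersion) ?_
  · filter_upwards [ae_torusProb ae_dispersion_pos] with p hp
    have hz' : z ≤ 0 := hz
    rw [Real.norm_of_nonneg (inv_nonneg.2 (by linarith))]
    exact inv_anti₀ hp (by linarith)
  · filter_upwards [ae_torusProb ae_dispersion_pos] with p hp
    refine (continuousOn_const.sub continuousOn_id).inv₀ fun z hz => ?_
    have hz' : z ≤ 0 := hz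
    change dispersion p - z ≠ 0
    linarith

/-- A positive correlation inequality: `(𝓔₀ - y)⁻¹` and `(𝓔₀ - z)⁻¹` are both decreasing functions
of `𝓔₀`, so the mean of their product `((𝓔₀ - z)⁻¹ - (𝓔₀ - y)⁻¹) / (z - y)` is at least the product
of their means. -/
theorem a₁₁_correlation {y z : ℝ} (hyz : y < z) (hz : z ≤ 0) :
    (z - y) * (a₁₁ z * a₁₁ y) ≤ a₁₁ z - a₁₁ y := by
  have ha := a₁₁_pos hz
  -- The value of `𝓔₀` at which `(𝓔₀ - z)⁻¹` attains its mean `a₁₁ z` is `z + (a₁₁ z)⁻¹`; centring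
  -- the second function at its value there makes the product of the differences nonnegative.
  set g₀ : ℝ := (z + (a₁₁ z)⁻¹ - y)⁻¹ with hg₀
  have hpt : ∀ᵐ p ∂torusProb,
      0 ≤ ((dispersion p - z)⁻¹ - (dispersion p - y)⁻¹) -
        (z - y) * (a₁₁ z * (dispersion p - y)⁻¹ + g₀ * (dispersion p - z)⁻¹ - g₀ * a₁₁ z) := by
    filter_upwards [ae_torusProb ae_dispersion_pos] with p hp
    set s := dispersion p - z with hs
    have hs0 : 0 < s := by linarith
    have hy : dispersion p - y = s + (z - y) := by rw [hs]; ring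
    have hd : 0 < z - y := sub_pos.2 hyz
    have hg : g₀ = ((a₁₁ z)⁻¹ + (z - y))⁻¹ := by rw [hg₀]; congr 1; ring
    rw [hy, hg]
    generalize z - y = d at hd
    generalize a₁₁ z = a at ha
    have e : (s⁻¹ - (s + d)⁻¹) - d * (a * (s + d)⁻¹ + (a⁻¹ + d)⁻¹ * s⁻¹ - (a⁻¹ + d)⁻¹ * a) =
        d * (1 - a * s) ^ 2 * (s⁻¹ * (s + d)⁻¹ * (1 + a * d)⁻¹) := by
      have h1 : s + d ≠ 0 := by positivity
      have h2 : 1 + a * d ≠ 0 := by positivity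
      have h3 : (a⁻¹ + d)⁻¹ = a * (1 + a * d)⁻¹ := by
        field_simp
      rw [h3]
      field_simp
      ring
    rw [e]
    positivity
  have hi1 := integrable_inv_dispersion_sub hz
  have hi2 := integrable_inv_dispersion_sub (hyz.le.trans hz)
  have h := integral_nonneg_of_ae hpt
  have hi3 : Integrable (fun p => a₁₁ z * (dispersion p - y)⁻¹ + g₀ * (dispersion p - z)⁻¹)
    torusProb := (hi2.const_mul _).add (hi1.const_mul _)
  have hi4 : Integrable (fun p => (dispersion p - z)⁻¹ - (dispersion p - y)⁻¹) torusProb :=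
    hi1.sub hi2
  have hi5 : Integrable (fun p => (z - y) *
      (a₁₁ z * (dispersion p - y)⁻¹ + g₀ * (dispersion p - z)⁻¹ - g₀ * a₁₁ z)) torusProb :=
    (hi3.sub (integrable_const _)).const_mul _
  rw [integral_sub hi4 hi5,
    integral_sub hi1 hi2, integral_const_mul,
    integral_sub hi3 (integrable_const _),
    integral_add (hi2.const_mul _) (hi1.const_mul _), integral_const_mul, integral_const_mul,
    integral_const, probReal_univ, one_smul, ← a₁₁_eq, ← a₁₁_eq] at h
  linarith

/-! ### Zeros of the Fredholm determinant -/

/-- The nondecreasing function `t ↦ 24 a₁₁(-t) / ((12 + t) a₁₁(-t) - 1)`, whose value at `0` is `μ₀`.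
For `z = -t < 0` the eigenvalue equation is `(12 + t + μ₁) (edgeFun t + μ₂) = 24`. -/
def edgeFun (t : ℝ) : ℝ := 24 * a₁₁ (-t) / ((12 + t) * a₁₁ (-t) - 1)

theorem edgeFun_zero : edgeFun 0 = mu₀ := by
  simp [edgeFun, mu₀]

theorem edgeFun_denom_pos {t : ℝ} (ht : 0 ≤ t) : 0 < (12 + t) * a₁₁ (-t) - 1 := by
  simpa only [sub_neg_eq_add] using sub_mul_a₁₁_sub_one_pos (neg_nonpos.2 ht)

theorem continuousOn_edgeFun : ContinuousOn edgeFun (Set.Ici 0) := by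
  have h : ContinuousOn (fun t : ℝ => a₁₁ (-t)) (Set.Ici 0) :=
    continuousOn_a₁₁.comp continuousOn_neg fun t ht => Set.mem_Iic.2 (neg_nonpos.2 ht)
  exact (continuousOn_const.mul h).div
    (((continuousOn_const.add continuousOn_id).mul h).sub continuousOn_const)
    fun t ht => (edgeFun_denom_pos ht).ne'

theorem monotoneOn_edgeFun : MonotoneOn edgeFun (Set.Ici 0) := by
  intro s hs t ht hst
  rcases hst.eq_or_lt with rfl | hlt
  · exact le_rfl
  have h := a₁₁_correlation (neg_lt_neg hlt) (neg_nonpos.2 hs)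
  rw [edgeFun, edgeFun, div_le_div_iff₀ (edgeFun_denom_pos hs) (edgeFun_denom_pos ht)]
  linarith

theorem tendsto_edgeFun : Filter.Tendsto edgeFun Filter.atTop Filter.atTop := by
  have hlin : Filter.Tendsto (fun t : ℝ => t / 18) Filter.atTop Filter.atTop :=
    Filter.tendsto_id.atTop_div_const (by norm_num)
  refine Filter.tendsto_atTop_mono' _ ?_ hlin
  filter_upwards [Filter.eventually_ge_atTop 24] with t ht
  have h1 := le_a₁₁ (z := -t) (by linarith)
  have h2 := sub_mul_a₁₁_sub_one_le (z := -t) (by linarith)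
  rw [sub_neg_eq_add] at h1
  rw [sub_neg_eq_add, neg_neg] at h2
  have h3 := edgeFun_denom_pos (by linarith : (0 : ℝ) ≤ t)
  rw [edgeFun, le_div_iff₀ h3]
  have ht0 : 0 < t := by linarith
  calc t / 18 * ((12 + t) * a₁₁ (-t) - 1) ≤ t / 18 * (144 * ((12 + t)⁻¹ * t⁻¹)) :=
        mul_le_mul_of_nonneg_left h2 (by positivity)
    _ = 8 * (12 + t)⁻¹ := by
        field_simp
        norm_num
    _ ≤ 24 * (24 + t)⁻¹ := by
        rw [← div_eq_mul_inv, ← div_eq_mul_inv, div_le_div_iff₀ (by positivity) (by positivity)]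
        linarith
    _ ≤ 24 * a₁₁ (-t) := by linarith

section ProductEquation

variable {u v : ℝ → ℝ} {K : ℝ}

theorem exists_pos_branch (huc : ContinuousOn u (Set.Ici 0)) (hvc : ContinuousOn v (Set.Ici 0))
    (hu : Filter.Tendsto u Filter.atTop Filter.atTop)
    (hv : Filter.Tendsto v Filter.atTop Filter.atTop) (hK : 0 < K) (h0 : u 0 * v 0 < K) :
    ∃ t, 0 < t ∧ 0 < u t ∧ u t * v t = K := by
  -- Positive parts discard the branch on which both factors are negative.
  set h : ℝ → ℝ := fun t => max (u t) 0 * max (v t) 0 with hh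
  have hc : ContinuousOn h (Set.Ici 0) :=
    (huc.sup continuousOn_const).mul (hvc.sup continuousOn_const)
  have hlt : h 0 < K := by
    simp only [hh]
    rcases le_total (u 0) 0 with h1 | h1
    · simpa [max_eq_right h1] using hK
    rcases le_total (v 0) 0 with h2 | h2
    · simpa [max_eq_right h2] using hK
    rwa [max_eq_left h1, max_eq_left h2]
  obtain ⟨T, hT0, hTu, hTv⟩ := ((Filter.eventually_ge_atTop (0 : ℝ)).and
    ((hu.eventually_ge_atTop 1).and (hv.eventually_ge_atTop K))).exists
  have hTK : K ≤ h T := by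
    simp only [hh]
    rw [max_eq_left (by linarith), max_eq_left (by linarith)]
    nlinarith
  obtain ⟨t, ht, hteq⟩ := intermediate_value_Icc hT0 (hc.mono fun _ hx => hx.1) ⟨hlt.le, hTK⟩
  have hut : 0 < u t := by
    by_contra hn
    rw [hh] at hteq
    simp only [max_eq_right (not_lt.1 hn), zero_mul] at hteq
    exact hK.ne hteq
  have hvt : 0 < v t := by
    by_contra hn
    rw [hh] at hteq
    simp only [max_eq_right (not_lt.1 hn), mul_zero] at hteq
    exact hK.ne hteq
  refine ⟨t, lt_of_le_of_ne ht.1 fun h0t => ?_, hut, ?_⟩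
  · rw [← h0t] at hteq
    exact hlt.ne hteq
  · simpa only [hh, max_eq_left hut.le, max_eq_left hvt.le] using hteq

theorem exists_neg_branch (huc : ContinuousOn u (Set.Ici 0)) (hvc : ContinuousOn v (Set.Ici 0))
    (hu : Filter.Tendsto u Filter.atTop Filter.atTop) (hK : 0 < K) (hu0 : u 0 < 0)
    (h0 : K < u 0 * v 0) :
    ∃ t, 0 < t ∧ u t < 0 ∧ u t * v t = K := by
  set h : ℝ → ℝ := fun t => max (-u t) 0 * max (-v t) 0 with hh
  have hc : ContinuousOn h (Set.Ici 0) :=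
    (huc.neg.sup continuousOn_const).mul (hvc.neg.sup continuousOn_const)
  have hv0 : v 0 < 0 := by
    by_contra hn
    nlinarith [not_lt.1 hn]
  have hlt : K < h 0 := by
    simp only [hh]
    rw [max_eq_left (by linarith), max_eq_left (by linarith)]
    linarith
  obtain ⟨T, hT0, hTu⟩ :=
    ((Filter.eventually_ge_atTop (0 : ℝ)).and (hu.eventually_ge_atTop 0)).exists
  have hTK : h T ≤ K := by
    simp only [hh]
    rw [max_eq_right (by linarith), zero_mul]
    exact hK.le
  obtain ⟨t, ht, hteq⟩ := intermediate_value_Icc' hT0 (hc.mono fun _ hx => hx.1) ⟨hTK, hlt.le⟩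
  have hut : u t < 0 := by
    by_contra hn
    rw [hh] at hteq
    simp only [max_eq_right (neg_nonpos.2 (not_lt.1 hn)), zero_mul] at hteq
    exact hK.ne hteq
  have hvt : v t < 0 := by
    by_contra hn
    rw [hh] at hteq
    simp only [max_eq_right (neg_nonpos.2 (not_lt.1 hn)), mul_zero] at hteq
    exact hK.ne hteq
  refine ⟨t, lt_of_le_of_ne ht.1 fun h0t => ?_, hut, ?_⟩
  · rw [← h0t] at hteq
    exact hlt.ne' hteq
  · rw [← hteq]
    simp only [hh]
    rw [max_eq_left (by linarith), max_eq_left (by linarith)]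
    ring

theorem mul_lt_mul_pos_branch (hum : StrictMonoOn u (Set.Ici 0)) (hvm : MonotoneOn v (Set.Ici 0))
    (hK : 0 < K) {s t : ℝ} (hs : 0 ≤ s) (hst : s < t) (hus : 0 < u s) (hK' : K ≤ u s * v s) :
    K < u t * v t := by
  have h1 := hum hs (hs.trans hst.le) hst
  have h2 := hvm hs (hs.trans hst.le) hst.le
  have hvs : 0 < v s := pos_of_mul_pos_right (hK.trans_le hK') hus.le
  exact hK'.trans_lt (mul_lt_mul h1 h2 hvs (hus.trans h1).le)

theorem mul_lt_mul_neg_branch (hum : StrictMonoOn u (Set.Ici 0)) (hvm : MonotoneOn v (Set.Ici 0))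
    (hK : 0 < K) {s t : ℝ} (hs : 0 ≤ s) (hst : s < t) (hut : u t < 0) (hK' : K ≤ u t * v t) :
    K < u s * v s := by
  have h1 := hum hs (hs.trans hst.le) hst
  have h2 := hvm hs (hs.trans hst.le) hst.le
  have hvt : v t < 0 := by
    by_contra hn
    nlinarith [not_lt.1 hn]
  nlinarith

theorem eq_of_pos_branch (hum : StrictMonoOn u (Set.Ici 0)) (hvm : MonotoneOn v (Set.Ici 0))
    (hK : 0 < K) {s t : ℝ} (hs : 0 < s) (ht : 0 < t) (hus : 0 < u s) (hut : 0 < u t)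
    (hs' : u s * v s = K) (ht' : u t * v t = K) : s = t := by
  rcases lt_trichotomy s t with h | h | h
  · exact absurd ht' (mul_lt_mul_pos_branch hum hvm hK hs.le h hus hs'.ge).ne'
  · exact h
  · exact absurd hs' (mul_lt_mul_pos_branch hum hvm hK ht.le h hut ht'.ge).ne'

theorem eq_of_neg_branch (hum : StrictMonoOn u (Set.Ici 0)) (hvm : MonotoneOn v (Set.Ici 0))
    (hK : 0 < K) {s t : ℝ} (hs : 0 < s) (ht : 0 < t) (hus : u s < 0) (hut : u t < 0)
    (hs' : u s * v s = K) (ht' : u t * v t = K) : s = t := by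
  rcases lt_trichotomy s t with h | h | h
  · exact absurd hs' (mul_lt_mul_neg_branch hum hvm hK hs.le h hut ht'.ge).ne'
  · exact h
  · exact absurd ht' (mul_lt_mul_neg_branch hum hvm hK ht.le h hus hs'.ge).ne'

theorem sign_of_mul_eq (hK : 0 < K) {t : ℝ} (h : u t * v t = K) : 0 < u t ∨ u t < 0 := by
  rcases lt_trichotomy (u t) 0 with h1 | h1 | h1
  · exact Or.inr h1
  · rw [h1, zero_mul] at h
    exact absurd h hK.ne
  · exact Or.inl h1

/-- The number of positive solutions of `u t * v t = K` for increasing factors `u` and `v`. On the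
part of the half-line where both factors are positive the product increases to infinity, on the part
where both are negative it decreases to `0`, and elsewhere it is nonpositive. -/
theorem mul_eq_solutions (hum : StrictMonoOn u (Set.Ici 0)) (hvm : MonotoneOn v (Set.Ici 0))
    (huc : ContinuousOn u (Set.Ici 0)) (hvc : ContinuousOn v (Set.Ici 0))
    (hu : Filter.Tendsto u Filter.atTop Filter.atTop)
    (hv : Filter.Tendsto v Filter.atTop Filter.atTop) (hK : 0 < K) :
    (0 < u 0 → K < u 0 * v 0 → ∀ t, 0 < t → u t * v t ≠ K) ∧
    (u 0 * v 0 < K → ∃ s, 0 < s ∧ ∀ t, 0 < t → (u t * v t = K ↔ t = s)) ∧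
    (u 0 < 0 → K < u 0 * v 0 → ∃ r s, 0 < r ∧ 0 < s ∧ r ≠ s ∧
      ∀ t, 0 < t → (u t * v t = K ↔ t = r ∨ t = s)) := by
  refine ⟨fun hu0 h0 t ht => (mul_lt_mul_pos_branch hum hvm hK le_rfl ht hu0 h0.le).ne',
    fun h0 => ?_, fun hu0 h0 => ?_⟩
  · obtain ⟨s, hs, hus, hs'⟩ := exists_pos_branch huc hvc hu hv hK h0
    refine ⟨s, hs, fun t ht => ⟨fun ht' => ?_, fun h => h ▸ hs'⟩⟩
    rcases sign_of_mul_eq hK ht' with hut | hut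
    · exact eq_of_pos_branch hum hvm hK ht hs hut hus ht' hs'
    · exact absurd h0 (mul_lt_mul_neg_branch hum hvm hK le_rfl ht hut ht'.ge).not_gt
  · obtain ⟨r, hr, hur, hr'⟩ := exists_neg_branch huc hvc hu hK hu0 h0
    -- Past `r` the product drops below `K`, so the positive branch starts from the zero of `u`.
    obtain ⟨T, hT0, hTu⟩ :=
      ((Filter.eventually_ge_atTop (0 : ℝ)).and (hu.eventually_ge_atTop 0)).exists
    obtain ⟨c, hc, huc0⟩ :=
      intermediate_value_Icc hT0 (huc.mono fun _ hx => hx.1) ⟨hu0.le, hTu⟩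
    have hsub : ∀ x : ℝ, x ∈ Set.Ici 0 → x + c ∈ Set.Ici (0 : ℝ) :=
      fun x hx => add_nonneg hx hc.1
    have hshift : Filter.Tendsto (fun x : ℝ => x + c) Filter.atTop Filter.atTop :=
      Filter.tendsto_atTop_add_const_right _ _ Filter.tendsto_id
    have hadd : ContinuousOn (fun x : ℝ => x + c) (Set.Ici 0) := by fun_prop
    obtain ⟨s, hs, hus, hs'⟩ := exists_pos_branch (u := fun x => u (x + c))
      (v := fun x => v (x + c)) (huc.comp hadd hsub) (hvc.comp hadd hsub) (hu.comp hshift)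
      (hv.comp hshift) hK (by simpa [huc0] using hK)
    have hs0 : 0 < s + c := add_pos_of_pos_of_nonneg hs hc.1
    refine ⟨r, s + c, hr, hs0, fun h => ?_, fun t ht => ⟨fun ht' => ?_, ?_⟩⟩
    · rw [h] at hur
      exact hur.not_gt hus
    · rcases sign_of_mul_eq hK ht' with hut | hut
      · exact Or.inr (eq_of_pos_branch hum hvm hK ht hs0 hut hus ht' hs')
      · exact Or.inl (eq_of_neg_branch hum hvm hK ht hr hut hur ht' hr')
    · rintro (rfl | rfl)
      · exact hr'
      · exact hs'

end ProductEquation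

/-- The Fredholm determinant `Δ(z) = (1 + μ₁ a₁₁) (1 + μ₂ a₂₂) - μ₁ μ₂ a₁₂²` of `Hˢ - z`, written
in terms of `a₁₁` alone. -/
def fredholmDet (μ₁ μ₂ z : ℝ) : ℝ :=
  1 + μ₁ * a₁₁ z + μ₂ / 24 * ((12 - z) * a₁₁ z - 1) * (12 - z + μ₁)

theorem fredholmDet_reflect (μ₁ μ₂ z : ℝ) :
    fredholmDet μ₁ μ₂ (24 - z) = fredholmDet (-μ₁) (-μ₂) z := by
  rw [fredholmDet, fredholmDet, sub_mul_a₁₁_reflect, a₁₁_reflect]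
  ring

theorem fredholmDet_neg_eq_zero_iff {μ₁ μ₂ t : ℝ} (ht : 0 ≤ t) :
    fredholmDet μ₁ μ₂ (-t) = 0 ↔ (12 + t + μ₁) * (edgeFun t + μ₂) = 24 := by
  have h := edgeFun_denom_pos ht
  have e : fredholmDet μ₁ μ₂ (-t) =
      ((12 + t) * a₁₁ (-t) - 1) / 24 * ((12 + t + μ₁) * (edgeFun t + μ₂) - 24) := by
    have hD : ((12 + t) * a₁₁ (-t) - 1) * edgeFun t = 24 * a₁₁ (-t) := by
      rw [edgeFun, mul_div_cancel₀ _ h.ne']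
    rw [fredholmDet]
    linear_combination -(12 + t + μ₁) / 24 * hD
  rw [e, mul_eq_zero, sub_eq_zero]
  exact or_iff_right (by positivity)

theorem mem_regionMinus_zero {μ₁ μ₂ : ℝ} (h : (μ₁, μ₂) ∈ regionMinus 0) :
    0 < 12 + μ₁ ∧ 24 < (12 + μ₁) * (mu₀ + μ₂) := by
  obtain ⟨h1, h2⟩ : -12 < μ₁ ∧ curveMinus μ₁ < μ₂ := h
  have h3 : 0 < μ₁ + 12 := by linarith
  rw [curveMinus, sub_lt_iff_lt_add, div_lt_iff₀ h3] at h2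
  constructor <;> linarith

theorem mem_regionMinus_one {μ₁ μ₂ : ℝ} (h : (μ₁, μ₂) ∈ regionMinus 1) :
    (12 + μ₁) * (mu₀ + μ₂) < 24 := by
  have h' : ((-12 < μ₁ ∧ μ₂ < curveMinus μ₁) ∨ μ₁ = -12) ∨ (μ₁ < -12 ∧ curveMinus μ₁ < μ₂) := h
  rcases h' with (⟨h1, h2⟩ | h1) | ⟨h1, h2⟩
  · rw [curveMinus, lt_sub_iff_add_lt, lt_div_iff₀ (by linarith)] at h2
    linarith
  · rw [h1]
    norm_num
  · rw [curveMinus, sub_lt_iff_lt_add, div_lt_iff_of_neg (by linarith)] at h2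
    linarith

theorem mem_regionMinus_two {μ₁ μ₂ : ℝ} (h : (μ₁, μ₂) ∈ regionMinus 2) :
    12 + μ₁ < 0 ∧ 24 < (12 + μ₁) * (mu₀ + μ₂) := by
  obtain ⟨h1, h2⟩ : μ₁ < -12 ∧ μ₂ < curveMinus μ₁ := h
  rw [curveMinus, lt_sub_iff_add_lt, lt_div_iff_of_neg (by linarith)] at h2
  constructor <;> linarith

theorem mem_regionPlus_iff {μ₁ μ₂ : ℝ} (ζ : Fin 3) :
    (μ₁, μ₂) ∈ regionPlus ζ ↔ (-μ₁, -μ₂) ∈ regionMinus ζ := by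
  have h1 : -12 < -μ₁ ↔ μ₁ < 12 := neg_lt_neg_iff
  have h2 : -μ₁ < -12 ↔ 12 < μ₁ := neg_lt_neg_iff
  have h3 : -μ₁ = -12 ↔ μ₁ = 12 := neg_inj
  have hc : curveMinus (-μ₁) = -curvePlus μ₁ := by
    rw [curveMinus, curvePlus, neg_add, ← div_neg, neg_sub, neg_add_eq_sub, sub_eq_add_neg]
  fin_cases ζ <;>
    simp [regionPlus, regionMinus, h1, h2, h3, hc]

theorem exists_zeros_neg {μ₁ μ₂ : ℝ} {ζ : Fin 3} (h : (μ₁, μ₂) ∈ regionMinus ζ) :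
    ∃ Z : Finset ℝ, Z.card = ζ ∧ ∀ z, z ∈ Z ↔ z < 0 ∧ fredholmDet μ₁ μ₂ z = 0 := by
  obtain ⟨H0, H1, H2⟩ := mul_eq_solutions (K := 24) (u := fun t => 12 + t + μ₁)
    (v := fun t => edgeFun t + μ₂)
    (fun s _ t _ hst => by simpa using hst)
    (fun s hs t ht hst => by simpa using monotoneOn_edgeFun hs ht hst)
    (by fun_prop) (continuousOn_edgeFun.add continuousOn_const)
    (Filter.tendsto_atTop_add_const_right _ _
      (Filter.tendsto_atTop_add_const_left _ _ Filter.tendsto_id))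
    (Filter.tendsto_atTop_add_const_right _ _ tendsto_edgeFun) (by norm_num)
  simp only [add_zero, edgeFun_zero] at H0 H1 H2
  have key : ∀ z : ℝ, z < 0 → (fredholmDet μ₁ μ₂ z = 0 ↔
      (12 + -z + μ₁) * (edgeFun (-z) + μ₂) = 24) := fun z hz => by
    rw [← fredholmDet_neg_eq_zero_iff (by linarith), neg_neg]
  fin_cases ζ
  · obtain ⟨h1, h2⟩ := mem_regionMinus_zero h
    refine ⟨∅, rfl, fun z => ⟨fun hz => absurd hz (Finset.notMem_empty z), fun hz => ?_⟩⟩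
    exact absurd ((key z hz.1).1 hz.2) (H0 h1 h2 (-z) (neg_pos.2 hz.1))
  · obtain ⟨s, hs, H⟩ := H1 (mem_regionMinus_one h)
    refine ⟨{-s}, Finset.card_singleton _, fun z => ?_⟩
    rw [Finset.mem_singleton]
    refine ⟨fun hz => ?_, fun hz => ?_⟩
    · have hz0 : z < 0 := by linarith
      exact ⟨hz0, (key z hz0).2 ((H (-z) (neg_pos.2 hz0)).2 (by linarith))⟩
    · linarith [(H (-z) (neg_pos.2 hz.1)).1 ((key z hz.1).1 hz.2)]
  · obtain ⟨h1, h2⟩ := mem_regionMinus_two h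
    obtain ⟨r, s, hr, hs, hne, H⟩ := H2 h1 h2
    refine ⟨{-r, -s}, Finset.card_pair fun h => hne (neg_injective h), fun z => ?_⟩
    rw [Finset.mem_insert, Finset.mem_singleton]
    refine ⟨fun hz => ?_, fun hz => ?_⟩
    · have hz0 : z < 0 := by rcases hz with hz | hz <;> linarith
      refine ⟨hz0, (key z hz0).2 ((H (-z) (neg_pos.2 hz0)).2 ?_)⟩
      exact hz.imp (fun h => by linarith) (fun h => by linarith)
    · exact ((H (-z) (neg_pos.2 hz.1)).1 ((key z hz.1).1 hz.2)).imp
        (fun h => by linarith) (fun h => by linarith)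

theorem exists_zeros_above {μ₁ μ₂ : ℝ} {ζ : Fin 3} (h : (μ₁, μ₂) ∈ regionPlus ζ) :
    ∃ Z : Finset ℝ, Z.card = ζ ∧ ∀ z, z ∈ Z ↔ 24 < z ∧ fredholmDet μ₁ μ₂ z = 0 := by
  obtain ⟨Z, hcard, hZ⟩ := exists_zeros_neg ((mem_regionPlus_iff ζ).1 h)
  refine ⟨Z.map (Equiv.subLeft (24 : ℝ)).toEmbedding, by rw [Finset.card_map, hcard],
    fun z => ?_⟩
  rw [Finset.mem_map_equiv, hZ]
  have e : (Equiv.subLeft (24 : ℝ)).symm z = 24 - z := by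
    rw [Equiv.symm_apply_eq]
    simp
  rw [e, ← fredholmDet_reflect, sub_sub_cancel, sub_neg]

/-! ### Eigenvectors outside `[0, 24]` -/

theorem continuous_alpha₁ : Continuous alpha₁ := continuous_const

theorem continuous_alpha₂ : Continuous alpha₂ := continuous_cosSum.div_const _

/-- Multiplication by `12 - 𝓔₀` maps `α₁` to a multiple of `α₂`. -/
theorem alpha₂_eq (p : Torus3) : 2 * √6 * alpha₂ p = (12 - dispersion p) * alpha₁ p := by
  have h1 : √(12 * π ^ 3) = √6 * √(2 * π ^ 3) := by
    rw [← Real.sqrt_mul (by norm_num)]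
    congr 1
    ring
  have h2 : √(8 * π ^ 3) = 2 * √(2 * π ^ 3) := by
    rw [show (8 : ℝ) * π ^ 3 = 2 ^ 2 * (2 * π ^ 3) by ring, Real.sqrt_mul (by norm_num),
      Real.sqrt_sq (by norm_num)]
  have h3 : (0 : ℝ) < √(2 * π ^ 3) := Real.sqrt_pos.2 (by positivity)
  rw [alpha₂, alpha₁, h1, h2, dispersion_eq, cosSum]
  field_simp
  ring

/-- The matrix element `a₂₂(z) = ∫ α₂² / (𝓔₀ - z)`. -/
def a₂₂ (z : ℝ) : ℝ := ∫ p : Torus3, alpha₂ p * alpha₂ p / (dispersion p - z)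

theorem integrable_volume {f : Torus3 → ℝ} (h : Continuous f) : Integrable f volume :=
  h.integrable_of_hasCompactSupport (HasCompactSupport.of_compactSpace f)

theorem integral_alpha₁_mul_alpha₁ : ∫ p, alpha₁ p * alpha₁ p = 1 := by
  have h := integral_torusProb fun _ => 1
  simp only [alpha₁_mul_alpha₁]
  rw [← integral_const_mul, integral_const, probReal_univ, one_smul] at h
  simpa only [mul_one] using h.symm

theorem integral_alpha₁_mul_alpha₂ : ∫ p, alpha₁ p * alpha₂ p = 0 := by
  have h6 : (2 : ℝ) * √6 ≠ 0 := by positivity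
  have h : ∫ p, (12 - dispersion p) * (alpha₁ p * alpha₁ p) = 0 := by
    have h1 : ∫ p, (12 - dispersion p) ∂torusProb = 0 := by
      rw [integral_sub (integrable_const _) (integrable_of_continuous continuous_dispersion),
        integral_dispersion, integral_const, probReal_univ, one_smul, sub_self]
    simp only [alpha₁_mul_alpha₁]
    rw [integral_mul_const, mul_comm, ← integral_torusProb, h1]
  refine mul_left_cancel₀ h6 ?_
  rw [mul_zero, ← integral_const_mul, ← h]
  congr 1
  ext p
  linear_combination alpha₁ p * alpha₂_eq p

/-- Replacing `α₂` by `α₁` in an integral against `g / (𝓔₀ - z)`: write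
`12 - 𝓔₀ = (12 - z) - (𝓔₀ - z)`. -/
theorem integral_alpha₂_div {z : ℝ} (hz : z ∉ Set.Icc (0 : ℝ) 24) {g : Torus3 → ℝ}
    (hg : Continuous g) :
    2 * √6 * ∫ p, g p * alpha₂ p / (dispersion p - z) =
      (12 - z) * (∫ p, alpha₁ p * g p / (dispersion p - z)) - ∫ p, alpha₁ p * g p := by
  have h1 : Continuous fun p => alpha₁ p * g p := continuous_alpha₁.mul hg
  have h2 : Continuous fun p => alpha₁ p * g p / (dispersion p - z) :=
    h1.div (continuous_dispersion.sub continuous_const) (dispersion_sub_ne_zero hz)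
  rw [← integral_const_mul, ← integral_const_mul,
    ← integral_sub ((integrable_volume h2).const_mul _) (integrable_volume h1)]
  congr 1
  ext p
  have h := dispersion_sub_ne_zero hz p
  field_simp
  linear_combination g p * alpha₂_eq p

theorem a₁₂_eq {z : ℝ} (hz : z ∉ Set.Icc (0 : ℝ) 24) :
    2 * √6 * a₁₂ z = (12 - z) * a₁₁ z - 1 := by
  rw [a₁₂, integral_alpha₂_div hz continuous_alpha₁, integral_alpha₁_mul_alpha₁, a₁₁]

theorem a₂₂_eq {z : ℝ} (hz : z ∉ Set.Icc (0 : ℝ) 24) :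
    2 * √6 * a₂₂ z = (12 - z) * a₁₂ z := by
  rw [a₂₂, integral_alpha₂_div hz continuous_alpha₂, integral_alpha₁_mul_alpha₂, a₁₂, sub_zero]

theorem a₁₂_ne_zero {z : ℝ} (hz : z ∉ Set.Icc (0 : ℝ) 24) : a₁₂ z ≠ 0 := by
  intro h
  have h1 := a₁₂_eq hz
  rw [h, mul_zero] at h1
  rcases lt_or_ge z 0 with h0 | h0
  · exact (sub_mul_a₁₁_sub_one_pos h0.le).ne h1
  · have h24 : 24 < z := lt_of_not_ge fun h => hz ⟨h0, h⟩
    have h2 := sub_mul_a₁₁_sub_one_pos (z := 24 - z) (by linarith)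
    rw [sub_mul_a₁₁_reflect] at h2
    exact h2.ne h1

theorem fredholmDet_eq {z : ℝ} (hz : z ∉ Set.Icc (0 : ℝ) 24) (μ₁ μ₂ : ℝ) :
    fredholmDet μ₁ μ₂ z = (1 + μ₁ * a₁₁ z) * (1 + μ₂ * a₂₂ z) - μ₁ * μ₂ * a₁₂ z ^ 2 := by
  have h6 : √6 ^ 2 = 6 := Real.sq_sqrt (by norm_num)
  have h12 := a₁₂_eq hz
  have h22 : 24 * a₂₂ z = (12 - z) * ((12 - z) * a₁₁ z - 1) := by
    rw [← h12]
    linear_combination 2 * √6 * a₂₂_eq hz - 4 * a₂₂ z * h6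
  have hsq : 24 * a₁₂ z ^ 2 = ((12 - z) * a₁₁ z - 1) ^ 2 := by
    rw [← h12]
    linear_combination -4 * a₁₂ z ^ 2 * h6
  rw [fredholmDet]
  linear_combination -(1 + μ₁ * a₁₁ z) * μ₂ / 24 * h22 + μ₁ * μ₂ / 24 * hsq

/-- The pairing `∫ g f` of a real function with an element of `L²`. -/
def pairing (g : Torus3 → ℝ) (f : L2) : ℂ := ∫ q, (g q : ℂ) * f q

theorem integral_cosC_mul_eq {f : L2} (hf : f ∈ evenSymL2) (i j : Fin 3) :
    ∫ q : Torus3, (cosC (q i) : ℂ) * f q = ∫ q : Torus3, (cosC (q j) : ℂ) * f q := by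
  have hm := measurePreserving_perm (Equiv.swap i j)
  have h := integrable_cos_mul f j
  have hae : AEStronglyMeasurable (fun q : Torus3 => (cosC (q j) : ℂ) * f q)
      (volume.map fun p : Torus3 => fun k => p (Equiv.swap i j k)) := by
    rw [hm.map_eq]
    exact h.aestronglyMeasurable
  have e := integral_map hm.measurable.aemeasurable hae
  rw [hm.map_eq] at e
  rw [e]
  refine integral_congr_ae ?_
  filter_upwards [hf.2 (Equiv.swap i j)] with q hq
  simp only [hq, Equiv.swap_apply_right]

theorem pairing_cosSum (f : L2) :
    pairing cosSum f = ∑ i, ∫ q : Torus3, (cosC (q i) : ℂ) * f q := by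
  rw [pairing, ← integral_finsetSum _ fun i _ => integrable_cos_mul f i]
  congr 1
  ext q
  rw [cosSum, Complex.ofReal_sum, Finset.sum_mul]

theorem pairing_const_mul (c : ℝ) (g : Torus3 → ℝ) (f : L2) :
    pairing (fun p => c * g p) f = c * pairing g f := by
  rw [pairing, pairing, ← integral_const_mul]
  congr 1
  ext q
  push_cast
  ring

theorem alpha₁_mul_pairing (f : L2) (p : Torus3) :
    (alpha₁ p : ℂ) * pairing alpha₁ f = ((1 / (8 * π ^ 3) : ℝ) : ℂ) * ∫ q, f q := by
  have e : pairing alpha₁ f = (alpha₁ p : ℂ) * ∫ q, f q := by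
    rw [pairing, ← integral_const_mul]
    rfl
  rw [e, ← mul_assoc, ← Complex.ofReal_mul, alpha₁_mul_alpha₁]

theorem alpha₂_mul_pairing (f : L2) (p : Torus3) :
    (alpha₂ p : ℂ) * pairing alpha₂ f =
      ((1 / (12 * π ^ 3) : ℝ) : ℂ) * (cosSum p * pairing cosSum f) := by
  have e : alpha₂ = fun p => (√(12 * π ^ 3))⁻¹ * cosSum p := by
    ext p
    rw [alpha₂, cosSum, div_eq_inv_mul]
  have h : (√(12 * π ^ 3))⁻¹ * (√(12 * π ^ 3))⁻¹ = 1 / (12 * π ^ 3) := by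
    rw [← mul_inv, Real.mul_self_sqrt (by positivity), one_div]
  rw [e, pairing_const_mul, ← h]
  push_cast
  ring

/-- On symmetric functions the interaction has rank two. -/
theorem interactionFun_of_mem {f : L2} (hf : f ∈ evenSymL2) (μ₁ μ₂ : ℝ) (p : Torus3) :
    interactionFun μ₁ μ₂ f p =
      μ₁ * pairing alpha₁ f * alpha₁ p + μ₂ * pairing alpha₂ f * alpha₂ p := by
  have h1 := alpha₁_mul_pairing f p
  have h2 := alpha₂_mul_pairing f p
  have h0 : ∀ i, ∫ q : Torus3, (cosC (q i) : ℂ) * f q = ∫ q : Torus3, (cosC (q 0) : ℂ) * f q :=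
    fun i => integral_cosC_mul_eq hf i 0
  rw [pairing_cosSum] at h2
  simp only [h0, Finset.sum_const, Finset.card_univ, Fintype.card_fin, nsmul_eq_mul] at h2
  have h3 : interactionFun μ₁ μ₂ f p = ((μ₁ / (2 * π) ^ 3 : ℝ) : ℂ) * (∫ q, f q) +
      ((2 * μ₂ / (2 * π) ^ 3 : ℝ) : ℂ) *
        (cosSum p * ∫ q : Torus3, (cosC (q 0) : ℂ) * f q) := by
    simp only [interactionFun, h0, ← Finset.sum_mul, cosSum, Complex.ofReal_sum]
  have hπ : (π : ℂ) ≠ 0 := Complex.ofReal_ne_zero.2 Real.pi_pos.ne'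
  rw [h3, mul_assoc, mul_assoc, mul_comm (pairing alpha₁ f), mul_comm (pairing alpha₂ f), h1, h2]
  push_cast
  field_simp
  ring

theorem hamiltonianL2_eq_smul_iff {f : L2} (hf : f ∈ evenSymL2) (μ₁ μ₂ z : ℝ) :
    hamiltonianL2 μ₁ μ₂ f = (z : ℂ) • f ↔
      ∀ᵐ p : Torus3, ((dispersion p : ℂ) - z) * f p + (μ₁ * pairing alpha₁ f * alpha₁ p +
        μ₂ * pairing alpha₂ f * alpha₂ p) = 0 := by
  rw [Lp.ext_iff]
  have h1 := coeFn_hamiltonianL2 μ₁ μ₂ f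
  have h2 := Lp.coeFn_smul (z : ℂ) f
  constructor
  · intro h
    filter_upwards [h, h1, h2] with p h h1 h2
    rw [h1, h2, Pi.smul_apply, smul_eq_mul, hamiltonianFun, interactionFun_of_mem hf] at h
    linear_combination h
  · intro h
    filter_upwards [h, h1, h2] with p h h1 h2
    rw [h1, h2, Pi.smul_apply, smul_eq_mul, hamiltonianFun, interactionFun_of_mem hf]
    linear_combination h

theorem hasEigenvector_iff {μ₁ μ₂ z : ℝ} (f : evenSymL2) :
    Module.End.HasEigenvector (hamiltonianSym μ₁ μ₂) (z : ℂ) f ↔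
      hamiltonianL2 μ₁ μ₂ f = (z : ℂ) • (f : L2) ∧ f ≠ 0 := by
  rw [Module.End.hasEigenvector_iff, Module.End.mem_eigenspace_iff, Subtype.ext_iff]
  rfl

/-- Pairing with `g` of the combination `k α₁ / (𝓔₀ - z) + l α₂ / (𝓔₀ - z)`. -/
theorem pairing_of_ae_eq {z : ℝ} (hz : z ∉ Set.Icc (0 : ℝ) 24) {g : Torus3 → ℝ} (hg : Continuous g)
    {f : L2} {k l : ℂ}
    (h : ∀ᵐ p : Torus3, f p = (k * alpha₁ p + l * alpha₂ p) / ((dispersion p : ℂ) - z)) :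
    pairing g f = k * (∫ p, g p * alpha₁ p / (dispersion p - z) : ℝ) +
      l * (∫ p, g p * alpha₂ p / (dispersion p - z) : ℝ) := by
  have hint : ∀ α : Torus3 → ℝ, Continuous α →
      Integrable (fun p => ((g p * α p / (dispersion p - z) : ℝ) : ℂ)) volume := fun α hα =>
    (integrable_volume ((hg.mul hα).div (continuous_dispersion.sub continuous_const)
      (dispersion_sub_ne_zero hz))).ofReal
  rw [← integral_complex_ofReal, ← integral_complex_ofReal, ← integral_const_mul,
    ← integral_const_mul, ← integral_add ((hint _ continuous_alpha₁).const_mul k)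
      ((hint _ continuous_alpha₂).const_mul l)]
  refine integral_congr_ae ?_
  filter_upwards [h] with p hp
  rw [hp]
  push_cast
  ring

theorem pairing_alpha_of_ae_eq {z : ℝ} (hz : z ∉ Set.Icc (0 : ℝ) 24) {f : L2} {k l : ℂ}
    (h : ∀ᵐ p : Torus3, f p = (k * alpha₁ p + l * alpha₂ p) / ((dispersion p : ℂ) - z)) :
    pairing alpha₁ f = k * a₁₁ z + l * a₁₂ z ∧ pairing alpha₂ f = k * a₁₂ z + l * a₂₂ z := by
  refine ⟨pairing_of_ae_eq hz continuous_alpha₁ h, ?_⟩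
  have e : a₁₂ z = ∫ p, alpha₂ p * alpha₁ p / (dispersion p - z) := by
    simp only [a₁₂, mul_comm]
  rw [pairing_of_ae_eq hz continuous_alpha₂ h, ← e, a₂₂]

theorem ofReal_dispersion_sub_ne_zero {z : ℝ} (hz : z ∉ Set.Icc (0 : ℝ) 24) (p : Torus3) :
    (dispersion p : ℂ) - z ≠ 0 := by
  rw [← Complex.ofReal_sub]
  exact Complex.ofReal_ne_zero.2 (dispersion_sub_ne_zero hz p)

/-- An eigenvector outside `[0, 24]` is determined by its two pairings with `α₁` and `α₂`, which
solve a homogeneous linear system with determinant `Δ(z)`. If `μ₂ ≠ 0`, the first equation of the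
system alone fixes the pairings up to a scalar, because `a₁₂(z) ≠ 0`; if `μ₂ = 0`, only the pairing
with `α₁` enters the eigenvector. -/
theorem eigenvector_form {μ₁ μ₂ z : ℝ} (hz : z ∉ Set.Icc (0 : ℝ) 24) {f : L2}
    (hf : f ∈ evenSymL2) (hne : f ≠ 0) (h : hamiltonianL2 μ₁ μ₂ f = (z : ℂ) • f) :
    fredholmDet μ₁ μ₂ z = 0 ∧ ∃ C : ℂ, C ≠ 0 ∧
      (f : Torus3 → ℂ) =ᵐ[volume] fun p => C * (eigenfunctionForm μ₁ μ₂ z p : ℂ) := by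
  rw [hamiltonianL2_eq_smul_iff hf] at h
  set c₁ := pairing alpha₁ f with hc₁
  set c₂ := pairing alpha₂ f with hc₂
  have hrep : ∀ᵐ p : Torus3, f p =
      (-(μ₁ * c₁) * alpha₁ p + -(μ₂ * c₂) * alpha₂ p) / ((dispersion p : ℂ) - z) := by
    filter_upwards [h] with p hp
    rw [eq_div_iff (ofReal_dispersion_sub_ne_zero hz p)]
    linear_combination hp
  obtain ⟨e₁, e₂⟩ := pairing_alpha_of_ae_eq hz hrep
  rw [← hc₁] at e₁
  rw [← hc₂] at e₂
  have hdet := fredholmDet_eq hz μ₁ μ₂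
  have hdetC : (fredholmDet μ₁ μ₂ z : ℂ) = (1 + μ₁ * a₁₁ z) * (1 + μ₂ * a₂₂ z) -
      μ₁ * μ₂ * (a₁₂ z : ℂ) ^ 2 := by
    rw [hdet]
    push_cast
    ring
  have hzero : c₁ = 0 → c₂ = 0 → False := fun h1 h2 => hne <| by
    rw [Lp.eq_zero_iff_ae_eq_zero]
    filter_upwards [hrep] with p hp
    rw [hp, h1, h2]
    simp
  refine ⟨?_, ?_⟩
  · by_contra hD
    have hD' : (fredholmDet μ₁ μ₂ z : ℂ) ≠ 0 := Complex.ofReal_ne_zero.2 hD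
    refine hzero (mul_left_cancel₀ hD' ?_) (mul_left_cancel₀ hD' ?_)
    · rw [hdetC]
      linear_combination (1 + μ₂ * (a₂₂ z : ℂ)) * e₁ - μ₂ * (a₁₂ z : ℂ) * e₂
    · rw [hdetC]
      linear_combination (1 + μ₁ * (a₁₁ z : ℂ)) * e₂ - μ₁ * (a₁₂ z : ℂ) * e₁
  have hform : ∃ C : ℂ, (f : Torus3 → ℂ) =ᵐ[volume]
      fun p => C * (eigenfunctionForm μ₁ μ₂ z p : ℂ) := by
    by_cases hμ : μ₂ = 0
    · refine ⟨-(μ₁ * c₁), ?_⟩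
      filter_upwards [hrep] with p hp
      rw [hp, eigenfunctionForm, if_pos hμ, hμ]
      push_cast
      ring
    · have ha : (a₁₂ z : ℂ) ≠ 0 := Complex.ofReal_ne_zero.2 (a₁₂_ne_zero hz)
      have hμ' : (μ₂ : ℂ) ≠ 0 := Complex.ofReal_ne_zero.2 hμ
      refine ⟨-c₁ / (μ₂ * a₁₂ z), ?_⟩
      filter_upwards [hrep] with p hp
      have hp0 := ofReal_dispersion_sub_ne_zero hz p
      rw [hp, eigenfunctionForm, if_neg hμ]
      push_cast
      field_simp
      linear_combination (-(alpha₂ p : ℂ)) * e₁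
  obtain ⟨C, hC⟩ := hform
  refine ⟨C, fun h0 => hne ?_, hC⟩
  rw [Lp.eq_zero_iff_ae_eq_zero]
  filter_upwards [hC] with p hp
  rw [hp, h0, zero_mul, Pi.zero_apply]

theorem cosSum_neg (p : Torus3) : cosSum (-p) = cosSum p := by
  simp only [cosSum, Pi.neg_apply, cosC_neg]

theorem cosSum_perm (σ : Equiv.Perm (Fin 3)) (p : Torus3) :
    cosSum (fun i => p (σ i)) = cosSum p :=
  Equiv.sum_comp σ fun i => cosC (p i)

/-- A function of `∑ᵢ cos pᵢ` is even and symmetric. -/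
theorem toLp_mem_evenSymL2 {g : Torus3 → ℂ} (hg : MemLp g 2 volume) (φ : ℝ → ℂ)
    (hφ : ∀ p, g p = φ (cosSum p)) : hg.toLp g ∈ evenSymL2 := by
  have h := hg.coeFn_toLp
  constructor
  · change ∀ᵐ p, hg.toLp g (-p) = hg.toLp g p
    filter_upwards [h, measurePreserving_neg.quasiMeasurePreserving.ae h] with p h1 h2
    rw [h1, h2, hφ, hφ, cosSum_neg]
  · intro σ
    filter_upwards [h, (measurePreserving_perm σ).quasiMeasurePreserving.ae h] with p h1 h2
    rw [h1, h2, hφ, hφ, cosSum_perm]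

theorem memLp_of_continuous {g : Torus3 → ℂ} (hg : Continuous g) : MemLp g 2 volume := by
  obtain ⟨C, hC⟩ := isCompact_univ.exists_bound_of_continuousOn hg.continuousOn
  exact MemLp.of_bound hg.aestronglyMeasurable C
    (Filter.Eventually.of_forall fun p => hC p (Set.mem_univ p))

theorem exists_eigenvector {μ₁ μ₂ z : ℝ} (hz : z ∉ Set.Icc (0 : ℝ) 24)
    (hdet : fredholmDet μ₁ μ₂ z = 0) :
    ∃ f ∈ evenSymL2, f ≠ 0 ∧ hamiltonianL2 μ₁ μ₂ f = (z : ℂ) • f := by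
  -- The coefficients are those of `eigenfunctionForm μ₁ μ₂ z`.
  obtain ⟨k, l, hkl, h₁, h₂⟩ : ∃ k l : ℝ, k * a₁₁ z + l * a₁₂ z ≠ 0 ∧
      k + μ₁ * (k * a₁₁ z + l * a₁₂ z) = 0 ∧ l + μ₂ * (k * a₁₂ z + l * a₂₂ z) = 0 := by
    rw [fredholmDet_eq hz] at hdet
    by_cases hμ : μ₂ = 0
    · have h1 : 1 + μ₁ * a₁₁ z = 0 := by simpa [hμ] using hdet
      refine ⟨1, 0, fun h => ?_, by linarith, by simp [hμ]⟩
      rw [one_mul, zero_mul, add_zero] at h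
      simp [h] at h1
    · refine ⟨μ₁ * μ₂ * a₁₂ z, -(μ₂ * (1 + μ₁ * a₁₁ z)), ?_, by ring, ?_⟩
      · have e : μ₁ * μ₂ * a₁₂ z * a₁₁ z + -(μ₂ * (1 + μ₁ * a₁₁ z)) * a₁₂ z = -(μ₂ * a₁₂ z) := by
          ring
        rw [e]
        exact neg_ne_zero.2 (mul_ne_zero hμ (a₁₂_ne_zero hz))
      · linear_combination -μ₂ * hdet
  set g : Torus3 → ℂ := fun p => (k * alpha₁ p + l * alpha₂ p) / ((dispersion p : ℂ) - z) with hg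
  have hgc : Continuous g := by
    have h1 := Complex.continuous_ofReal.comp continuous_alpha₁
    have h2 := Complex.continuous_ofReal.comp continuous_alpha₂
    have h3 := Complex.continuous_ofReal.comp continuous_dispersion
    exact ((continuous_const.mul h1).add (continuous_const.mul h2)).div
      (h3.sub continuous_const) (ofReal_dispersion_sub_ne_zero hz)
  have hgm := memLp_of_continuous hgc
  have hmem : hgm.toLp g ∈ evenSymL2 :=
    toLp_mem_evenSymL2 hgm (fun s => (k * (1 / √(8 * π ^ 3) : ℝ) + l * (s / √(12 * π ^ 3) : ℝ)) /
      (((12 - 4 * s : ℝ) : ℂ) - z)) fun p => by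
        simp only [hg, dispersion_eq, alpha₁, alpha₂, cosSum]
  have hrep : ∀ᵐ p : Torus3, hgm.toLp g p =
      (k * alpha₁ p + l * alpha₂ p) / ((dispersion p : ℂ) - z) := hgm.coeFn_toLp
  obtain ⟨e₁, e₂⟩ := pairing_alpha_of_ae_eq hz hrep
  refine ⟨hgm.toLp g, hmem, fun h0 => hkl ?_, ?_⟩
  · have h3 : pairing alpha₁ (hgm.toLp g) = 0 := by
      simp [h0, pairing]
    rw [e₁] at h3
    exact_mod_cast h3
  · rw [hamiltonianL2_eq_smul_iff hmem, e₁, e₂]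
    filter_upwards [hrep] with p hp
    rw [hp, mul_div_cancel₀ _ (ofReal_dispersion_sub_ne_zero hz p)]
    have h₁' : (k : ℂ) + μ₁ * (k * a₁₁ z + l * a₁₂ z) = 0 := by exact_mod_cast h₁
    have h₂' : (l : ℂ) + μ₂ * (k * a₁₂ z + l * a₂₂ z) = 0 := by exact_mod_cast h₂
    linear_combination (alpha₁ p : ℂ) * h₁' + (alpha₂ p : ℂ) * h₂'

/-- Two functions that are nonzero multiples of the same function are multiples of each other. -/
theorem eq_smul_of_ae_eq {f g : L2} {φ : Torus3 → ℂ} {C D : ℂ} (hD : D ≠ 0)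
    (hf : (f : Torus3 → ℂ) =ᵐ[volume] fun p => C * φ p)
    (hg : (g : Torus3 → ℂ) =ᵐ[volume] fun p => D * φ p) : f = (C / D) • g := by
  rw [Lp.ext_iff]
  filter_upwards [hf, hg, Lp.coeFn_smul (C / D) g] with p h1 h2 h3
  rw [h1, h3, Pi.smul_apply, h2, smul_eq_mul, ← mul_assoc, div_mul_cancel₀ _ hD]

theorem hasEigenfunctionForm {μ₁ μ₂ z : ℝ} (hz : z ∉ Set.Icc (0 : ℝ) 24)
    (h : Module.End.HasEigenvalue (hamiltonianSym μ₁ μ₂) (z : ℂ)) :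
    HasEigenfunctionForm μ₁ μ₂ z := by
  intro f
  constructor
  · rw [hasEigenvector_iff]
    rintro ⟨hf, hne⟩
    exact (eigenvector_form hz f.2 (fun h0 => hne (Subtype.ext h0)) hf).2
  · rintro ⟨C, hC, hfC⟩
    obtain ⟨g, hg⟩ := h.exists_hasEigenvector
    have hg' := (hasEigenvector_iff g).1 hg
    obtain ⟨D, hD, hgD⟩ := (eigenvector_form hz g.2 (fun h0 => hg'.2 (Subtype.ext h0)) hg'.1).2
    have e : f = (C / D) • g := Subtype.ext (eq_smul_of_ae_eq hD hfC hgD)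
    rw [e]
    exact ⟨Submodule.smul_mem _ _ hg.1, smul_ne_zero (div_ne_zero hC hD) hg.2⟩

/-- Outside `[0, 24]` the eigenvalues are the zeros of the Fredholm determinant, and they are
simple. -/
theorem rank_eigenspace {μ₁ μ₂ z : ℝ} (hz : z ∉ Set.Icc (0 : ℝ) 24) :
    Cardinal.toENat (Module.rank ℂ (Module.End.eigenspace (hamiltonianSym μ₁ μ₂) (z : ℂ))) =
      if fredholmDet μ₁ μ₂ z = 0 then 1 else 0 := by
  split_ifs with hdet
  · obtain ⟨f, hf, hne, hfe⟩ := exists_eigenvector hz hdet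
    have hv : Module.End.HasEigenvector (hamiltonianSym μ₁ μ₂) (z : ℂ) ⟨f, hf⟩ :=
      (hasEigenvector_iff _).2 ⟨hfe, fun h => hne (congrArg Subtype.val h)⟩
    obtain ⟨D, hD, hfD⟩ := (eigenvector_form hz hf hne hfe).2
    have h1 : Module.rank ℂ (Module.End.eigenspace (hamiltonianSym μ₁ μ₂) (z : ℂ)) = 1 := by
      rw [rank_submodule_eq_one_iff]
      refine ⟨⟨f, hf⟩, hv.1, hv.2, fun g hg => ?_⟩
      rw [Submodule.mem_span_singleton]
      by_cases hg0 : g = 0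
      · exact ⟨0, by rw [hg0, zero_smul]⟩
      · have hg' := (hasEigenvector_iff g).1 ⟨hg, hg0⟩
        obtain ⟨C, -, hgC⟩ :=
          (eigenvector_form hz g.2 (fun h0 => hg0 (Subtype.ext h0)) hg'.1).2
        exact ⟨C / D, (Subtype.ext (eq_smul_of_ae_eq hD hgC hfD)).symm⟩
    rw [h1, map_one]
  · have h0 : Module.End.eigenspace (hamiltonianSym μ₁ μ₂) (z : ℂ) = ⊥ := by
      rw [Submodule.eq_bot_iff]
      intro g hg
      by_contra hg0
      have hg' := (hasEigenvector_iff g).1 ⟨hg, hg0⟩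
      exact hdet (eigenvector_form hz g.2 (fun h0 => hg0 (Subtype.ext h0)) hg'.1).1
    rw [h0, rank_bot, map_zero]

theorem eigenvalueCount_eq_card {μ₁ μ₂ : ℝ} {S : Set ℝ} (hS : Disjoint S (Set.Icc (0 : ℝ) 24))
    {Z : Finset ℝ} (hZ : ∀ z, z ∈ Z ↔ z ∈ S ∧ fredholmDet μ₁ μ₂ z = 0) :
    eigenvalueCount (hamiltonianSym μ₁ μ₂) S = Z.card := by
  have hsum : ∀ s : Finset ℝ, (s : Set ℝ) ⊆ S →
      ∑ z ∈ s, Cardinal.toENat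
        (Module.rank ℂ (Module.End.eigenspace (hamiltonianSym μ₁ μ₂) (z : ℂ))) =
      ((s.filter fun z => fredholmDet μ₁ μ₂ z = 0).card : ℕ∞) := fun s hs => by
    rw [Finset.sum_congr rfl fun z hz => rank_eigenspace (Set.disjoint_left.1 hS (hs hz)),
      Finset.sum_boole]
  refine le_antisymm (iSup₂_le fun s hs => ?_) ?_
  · rw [hsum s hs]
    refine Nat.cast_le.2 (Finset.card_le_card fun z hz => ?_)
    rw [Finset.mem_filter] at hz
    exact (hZ z).2 ⟨hs hz.1, hz.2⟩
  · have hZS : (Z : Set ℝ) ⊆ S := fun z hz => ((hZ z).1 hz).1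
    refine le_trans (le_of_eq ?_) (le_iSup₂ Z hZS)
    rw [hsum Z hZS, Finset.filter_true_of_mem fun z hz => ((hZ z).1 hz).2]

/-! ### The essential spectrum -/

/-- The operator of multiplication by `𝓔₀ - z` on `L²(𝕋³)`. -/
def mulDispersionSub (z : ℝ) (f : L2) : L2 :=
  (memLp_bdd_mul (continuous_dispersion.sub continuous_const) (Lp.memLp f) :
    MemLp (fun p => ((dispersion p - z : ℝ) : ℂ) * f p) 2 volume).toLp _

theorem coeFn_mulDispersionSub (z : ℝ) (f : L2) :
    (mulDispersionSub z f : Torus3 → ℂ) =ᵐ[volume]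
      fun p => ((dispersion p - z : ℝ) : ℂ) * f p :=
  MemLp.coeFn_toLp _

/-- The interaction is small on functions whose integrals against `1` and the `cos pᵢ` are small. -/
theorem tendsto_hamiltonianL2_sub (μ₁ μ₂ z : ℝ) {u : ℕ → L2}
    (h₁ : Filter.Tendsto (fun n => pairing (fun _ => 1) (u n)) Filter.atTop (nhds 0))
    (h₂ : ∀ i, Filter.Tendsto (fun n => pairing (fun p => cosC (p i)) (u n)) Filter.atTop
      (nhds 0)) :
    Filter.Tendsto
      (fun n => ‖(hamiltonianL2 μ₁ μ₂ (u n) - (z : ℂ) • u n) - mulDispersionSub z (u n)‖)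
      Filter.atTop (nhds 0) := by
  set B : ℕ → ℝ := fun n => ‖((μ₁ / (2 * π) ^ 3 : ℝ) : ℂ)‖ * ‖pairing (fun _ => 1) (u n)‖ +
    ‖((2 * μ₂ / (2 * π) ^ 3 : ℝ) : ℂ)‖ * ∑ i, ‖pairing (fun p => cosC (p i)) (u n)‖ with hB
  have hBlim : Filter.Tendsto B Filter.atTop (nhds 0) := by
    have h3 := (h₁.norm.const_mul ‖((μ₁ / (2 * π) ^ 3 : ℝ) : ℂ)‖).add
      ((tendsto_finsetSum Finset.univ fun i _ => (h₂ i).norm).const_mul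
        ‖((2 * μ₂ / (2 * π) ^ 3 : ℝ) : ℂ)‖)
    simpa only [norm_zero, mul_zero, Finset.sum_const_zero, add_zero] using h3
  have hB0 : ∀ n, 0 ≤ B n := fun n => by positivity
  have hbound : ∀ n, ‖(hamiltonianL2 μ₁ μ₂ (u n) - (z : ℂ) • u n) - mulDispersionSub z (u n)‖ ≤
      measureUnivNNReal (volume : Measure Torus3) ^ (2 : ℝ≥0∞).toReal⁻¹ * B n := fun n => by
    refine Lp.norm_le_of_ae_bound (hB0 n) ?_
    filter_upwards [Lp.coeFn_sub (hamiltonianL2 μ₁ μ₂ (u n) - (z : ℂ) • u n)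
      (mulDispersionSub z (u n)), Lp.coeFn_sub (hamiltonianL2 μ₁ μ₂ (u n)) ((z : ℂ) • u n),
      Lp.coeFn_smul (z : ℂ) (u n), coeFn_hamiltonianL2 μ₁ μ₂ (u n),
      coeFn_mulDispersionSub z (u n)] with p e1 e2 e3 e4 e5
    have e : ((hamiltonianL2 μ₁ μ₂ (u n) - (z : ℂ) • u n) - mulDispersionSub z (u n) : L2) p =
        interactionFun μ₁ μ₂ (u n) p := by
      rw [e1, Pi.sub_apply, e2, Pi.sub_apply, e3, Pi.smul_apply, e4, e5, hamiltonianFun]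
      simp only [smul_eq_mul, Complex.ofReal_sub]
      ring
    have e' : interactionFun μ₁ μ₂ (u n) p =
        ((μ₁ / (2 * π) ^ 3 : ℝ) : ℂ) * pairing (fun _ => 1) (u n) +
        ((2 * μ₂ / (2 * π) ^ 3 : ℝ) : ℂ) *
          ∑ i, (cosC (p i) : ℂ) * pairing (fun p => cosC (p i)) (u n) := by
      simp only [interactionFun, pairing, Complex.ofReal_one, one_mul]
    rw [e, e', hB]
    refine (norm_add_le _ _).trans (add_le_add (norm_mul_le _ _) ((norm_mul_le _ _).trans ?_))
    refine mul_le_mul_of_nonneg_left ((norm_sum_le _ _).trans (Finset.sum_le_sum fun i _ => ?_))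
      (norm_nonneg _)
    rw [norm_mul, Complex.norm_real, Real.norm_eq_abs]
    exact mul_le_of_le_one_left (norm_nonneg _) (abs_le.2 (cosC_mem_Icc (p i)))
  refine squeeze_zero (fun n => norm_nonneg _) hbound ?_
  simpa using hBlim.const_mul
    (measureUnivNNReal (volume : Measure Torus3) ^ (2 : ℝ≥0∞).toReal⁻¹ : ℝ)

/-- A real continuous function as an element of `L²(𝕋³)`. -/
def contL2 (g : Torus3 → ℝ) (hg : Continuous g) : L2 :=
  (memLp_of_continuous (Complex.continuous_ofReal.comp hg)).toLp _

theorem coeFn_contL2 {g : Torus3 → ℝ} (hg : Continuous g) :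
    (contL2 g hg : Torus3 → ℂ) =ᵐ[volume] fun p => (g p : ℂ) :=
  MemLp.coeFn_toLp _

theorem inner_contL2 {g : Torus3 → ℝ} (hg : Continuous g) (f : L2) :
    inner ℂ (contL2 g hg) f = pairing g f := by
  rw [L2.inner_def, pairing]
  refine integral_congr_ae ?_
  filter_upwards [coeFn_contL2 hg] with p hp
  rw [hp, RCLike.inner_apply, Complex.conj_ofReal, mul_comm]

theorem continuous_cosC_apply (i : Fin 3) : Continuous fun p : Torus3 => cosC (p i) :=
  continuous_cosC.comp (continuous_apply i)

theorem contL2_cosC_mem_evenL2 (i : Fin 3) :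
    contL2 (fun p => cosC (p i)) (continuous_cosC_apply i) ∈ evenL2 := by
  have h := coeFn_contL2 (continuous_cosC_apply i)
  change ∀ᵐ p, contL2 (fun p => cosC (p i)) (continuous_cosC_apply i) (-p) =
    contL2 (fun p => cosC (p i)) (continuous_cosC_apply i) p
  filter_upwards [h, measurePreserving_neg.quasiMeasurePreserving.ae h] with p h1 h2
  rw [h1, h2, Pi.neg_apply, cosC_neg]

theorem contL2_one_mem_evenSymL2 : contL2 (fun _ => 1) continuous_const ∈ evenSymL2 :=
  toLp_mem_evenSymL2 _ (fun _ => 1) fun _ => by simp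

theorem contL2_cosSum_mem_evenSymL2 : contL2 cosSum continuous_cosSum ∈ evenSymL2 :=
  toLp_mem_evenSymL2 _ (fun s => (s : ℂ)) fun _ => rfl

theorem pairing_cosC_of_mem {f : L2} (hf : f ∈ evenSymL2) (i : Fin 3) :
    pairing (fun p => cosC (p i)) f = 1 / 3 * pairing cosSum f := by
  have h0 : ∀ j, ∫ q : Torus3, (cosC (q j) : ℂ) * f q = ∫ q : Torus3, (cosC (q i) : ℂ) * f q :=
    fun j => integral_cosC_mul_eq hf j i
  rw [pairing_cosSum]
  simp only [h0, Finset.sum_const, Finset.card_univ, Fintype.card_fin, nsmul_eq_mul, pairing]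
  push_cast
  ring

/-- Off `[0, 24]` multiplication by `𝓔₀ - z` is bounded below, and the interaction kills weakly
null sequences in the limit, so there is no singular Weyl sequence. -/
theorem essentialSpectrum_restrict_subset {μ₁ μ₂ : ℝ} {K : Submodule ℂ L2}
    (hK : ∀ f ∈ K, hamiltonianL2 μ₁ μ₂ f ∈ K)
    (hw : ∀ u : ℕ → K,
      (∀ v : K, Filter.Tendsto (fun n => inner ℂ v (u n)) Filter.atTop (nhds 0)) →
      Filter.Tendsto (fun n => pairing (fun _ => 1) (u n)) Filter.atTop (nhds 0) ∧
      ∀ i, Filter.Tendsto (fun n => pairing (fun p => cosC (p i)) (u n)) Filter.atTop (nhds 0)) :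
    essentialSpectrum ((hamiltonianL2 μ₁ μ₂).restrict hK) ⊆ Set.Icc 0 24 := by
  rintro z ⟨u, hu1, huw, hu⟩
  by_contra hz
  obtain ⟨δ, hδ, hle⟩ : ∃ δ : ℝ, 0 < δ ∧ ∀ p, δ ≤ |dispersion p - z| := by
    rcases lt_or_ge z 0 with h | h
    · exact ⟨-z, by linarith, fun p =>
        le_trans (by linarith [(dispersion_mem_Icc p).1]) (le_abs_self _)⟩
    · have h24 : 24 < z := lt_of_not_ge fun h' => hz ⟨h, h'⟩
      exact ⟨z - 24, by linarith, fun p =>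
        le_trans (by linarith [(dispersion_mem_Icc p).2]) (neg_le_abs _)⟩
  have hlow : ∀ n, δ ≤ ‖mulDispersionSub z (u n)‖ := fun n => by
    have h1 : ‖(u n : L2)‖ ≤ δ⁻¹ * ‖mulDispersionSub z (u n)‖ := by
      refine Lp.norm_le_mul_norm_of_ae_le_mul ?_
      filter_upwards [coeFn_mulDispersionSub z (u n)] with p hp
      rw [hp, norm_mul, Complex.norm_real, Real.norm_eq_abs, inv_mul_eq_div, le_div_iff₀ hδ,
        mul_comm]
      exact mul_le_mul_of_nonneg_right (hle p) (norm_nonneg _)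
    have h2 : ‖(u n : L2)‖ = 1 := hu1 n
    rwa [h2, inv_mul_eq_div, le_div_iff₀ hδ, one_mul] at h1
  obtain ⟨h₁, h₂⟩ := hw u huw
  have h3 := tendsto_hamiltonianL2_sub μ₁ μ₂ z h₁ h₂
  have h4 : Filter.Tendsto (fun n => ‖hamiltonianL2 μ₁ μ₂ (u n) - (z : ℂ) • (u n : L2)‖)
    Filter.atTop (nhds 0) := hu
  have h5 := h4.add h3
  rw [add_zero] at h5
  refine hδ.not_ge (ge_of_tendsto' h5 fun n => (hlow n).trans ?_)
  have h6 := norm_sub_norm_le (mulDispersionSub z (u n))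
    (hamiltonianL2 μ₁ μ₂ (u n) - (z : ℂ) • (u n : L2))
  rw [norm_sub_rev (mulDispersionSub z (u n))] at h6
  linarith

theorem exists_dispersion_eq {x : ℝ} (hx : x ∈ Set.Icc (0 : ℝ) 24) :
    ∃ p : Torus3, dispersion p = x := by
  refine ⟨fun _ => ((Real.arccos (1 - x / 12) : ℝ) : AddCircle (2 * π)), ?_⟩
  simp only [dispersion, cosC_coe, Fin.sum_univ_three]
  rw [Real.cos_arccos (by linarith [hx.2]) (by linarith [hx.1])]
  ring

/-- The indicator of the set `{p | 𝓔₀(p) ∈ J}` as an element of `L²(𝕋³)`. -/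
def shell (J : Set ℝ) (hJ : IsOpen J) : L2 :=
  indicatorConstLp 2 (hJ.preimage continuous_dispersion).measurableSet (measure_ne_top volume _)
    (1 : ℂ)

theorem coeFn_shell {J : Set ℝ} (hJ : IsOpen J) :
    ∀ᵐ p, shell J hJ p = (dispersion ⁻¹' J).indicator (fun _ => (1 : ℂ)) p :=
  indicatorConstLp_coeFn

theorem shell_mem_evenSymL2 {J : Set ℝ} (hJ : IsOpen J) : shell J hJ ∈ evenSymL2 :=
  toLp_mem_evenSymL2 (memLp_indicator_const 2
    (hJ.preimage continuous_dispersion).measurableSet 1 (Or.inr (measure_ne_top volume _)))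
    (fun s => J.indicator (fun _ => (1 : ℂ)) (12 - 4 * s)) fun p => by
    rw [← dispersion_eq]
    rfl

theorem shell_ne_zero {J : Set ℝ} (hJ : IsOpen J) {x : ℝ} (hx : x ∈ J)
    (hx' : x ∈ Set.Icc (0 : ℝ) 24) : shell J hJ ≠ 0 := by
  intro h0
  obtain ⟨p, hp⟩ := exists_dispersion_eq hx'
  have hpos : 0 < volume (dispersion ⁻¹' J) :=
    (hJ.preimage continuous_dispersion).measure_pos volume ⟨p, by rwa [Set.mem_preimage, hp]⟩
  refine hpos.ne' (measure_eq_zero_iff_ae_notMem.2 ?_)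
  have h := coeFn_shell hJ
  rw [h0] at h
  filter_upwards [h, Lp.coeFn_zero ℂ 2 (volume : Measure Torus3)] with q h1 h2 hq
  rw [h2, Set.indicator_of_mem hq, Pi.zero_apply] at h1
  exact zero_ne_one h1

/-- Normalised indicators of the level shells `{𝓔₀ ∈ Jₙ}`, with disjoint open intervals `Jₙ`
converging to `z`, form an orthonormal sequence of approximate eigenvectors of `𝓔₀`. -/
theorem exists_orthonormal_shells {z : ℝ} (hz : z ∈ Set.Icc (0 : ℝ) 24) :
    ∃ u : ℕ → L2, (∀ n, u n ∈ evenSymL2) ∧ Orthonormal ℂ u ∧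
      ∀ n, ‖mulDispersionSub z (u n)‖ ≤ 12 * (1 / ((n : ℝ) + 1)) := by
  -- The intervals lie on the side of `z` on which there is room for an interval of length `12`.
  obtain ⟨d, hd, hroom⟩ : ∃ d : ℝ, |d| = 12 ∧
      ∀ t ∈ Set.Icc (0 : ℝ) 1, z + d * t ∈ Set.Icc 0 24 := by
    rcases le_total z 12 with h | h
    · exact ⟨12, by norm_num, fun t ht =>
        ⟨by linarith [hz.1, ht.1], by linarith [ht.2]⟩⟩
    · exact ⟨-12, by norm_num, fun t ht =>
        ⟨by linarith [ht.2], by linarith [hz.2, ht.1]⟩⟩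
  have hd0 : d ≠ 0 := by
    rintro rfl
    norm_num at hd
  set I : ℕ → Set ℝ := fun n => Set.Ioo (1 / ((n : ℝ) + 1 + 1)) (1 / ((n : ℝ) + 1)) with hI
  set J : ℕ → Set ℝ := fun n => (fun x => (x - z) / d) ⁻¹' I n with hJdef
  have hJ : ∀ n, IsOpen (J n) := fun n => isOpen_Ioo.preimage (by fun_prop)
  have hmono : ∀ m n : ℕ, m < n → 1 / ((n : ℝ) + 1) ≤ 1 / ((m : ℝ) + 1 + 1) := fun m n hmn => by
    refine one_div_le_one_div_of_le (by positivity) ?_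
    have : (m : ℝ) + 1 ≤ n := by exact_mod_cast hmn
    linarith
  have hdisj : ∀ m n : ℕ, m ≠ n → ∀ x, x ∈ J m → x ∉ J n := by
    intro m n hmn x hm hn
    rcases lt_or_gt_of_ne hmn with h | h
    · exact absurd (hm.1.trans hn.2) (hmono m n h).not_gt
    · exact absurd (hn.1.trans hm.2) (hmono n m h).not_gt
  have hne : ∀ n, shell (J n) (hJ n) ≠ 0 := fun n => by
    have hlt : 1 / ((n : ℝ) + 1 + 1) < 1 / ((n : ℝ) + 1) :=
      one_div_lt_one_div_of_lt (by positivity) (by linarith)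
    obtain ⟨t, ht1, ht2⟩ := exists_between hlt
    have h1 : 1 / ((n : ℝ) + 1) ≤ 1 := by
      rw [div_le_one (by positivity)]
      linarith [n.cast_nonneg (α := ℝ)]
    have h0 : 0 < 1 / ((n : ℝ) + 1 + 1) := by positivity
    refine shell_ne_zero (hJ n) (x := z + d * t) ?_ (hroom t ⟨(h0.trans ht1).le, by linarith⟩)
    have e : (z + d * t - z) / d = t := by
      field_simp
      ring
    change (z + d * t - z) / d ∈ I n
    rw [e]
    exact ⟨ht1, ht2⟩
  set u : ℕ → L2 := fun n => ((‖shell (J n) (hJ n)‖⁻¹ : ℝ) : ℂ) • shell (J n) (hJ n) with hu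
  have hnorm : ∀ n, ‖u n‖ = 1 := fun n => by
    rw [hu, norm_smul, Complex.norm_real, norm_inv, norm_norm,
      inv_mul_cancel₀ (norm_ne_zero_iff.2 (hne n))]
  refine ⟨u, fun n => Submodule.smul_mem _ _ (shell_mem_evenSymL2 (hJ n)),
    ⟨hnorm, fun m n hmn => ?_⟩, fun n => ?_⟩
  · change inner ℂ (u m) (u n) = 0
    rw [hu, inner_smul_left, inner_smul_right, L2.inner_def]
    have h0 : ∫ p, inner ℂ (shell (J m) (hJ m) p) (shell (J n) (hJ n) p) = 0 := by
      refine integral_eq_zero_of_ae ?_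
      filter_upwards [coeFn_shell (hJ m), coeFn_shell (hJ n)] with p h1 h2
      rw [h1, h2]
      by_cases hm : dispersion p ∈ J m
      · rw [Set.indicator_of_notMem (s := dispersion ⁻¹' J n) (hdisj m n hmn _ hm),
          inner_zero_right, Pi.zero_apply]
      · rw [Set.indicator_of_notMem (s := dispersion ⁻¹' J m) hm, inner_zero_left, Pi.zero_apply]
    rw [h0, mul_zero, mul_zero]
  · have h := Lp.norm_le_mul_norm_of_ae_le_mul (c := 12 * (1 / ((n : ℝ) + 1)))
      (f := mulDispersionSub z (u n)) (g := u n) ?_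
    · rwa [hnorm, mul_one] at h
    filter_upwards [coeFn_mulDispersionSub z (u n), coeFn_shell (hJ n),
      Lp.coeFn_smul ((‖shell (J n) (hJ n)‖⁻¹ : ℝ) : ℂ) (shell (J n) (hJ n))] with p h1 h2 h3
    have h3' : u n p = ((‖shell (J n) (hJ n)‖⁻¹ : ℝ) : ℂ) * shell (J n) (hJ n) p := h3
    rw [h1, norm_mul, Complex.norm_real, Real.norm_eq_abs]
    by_cases hp : dispersion p ∈ J n
    · refine mul_le_mul_of_nonneg_right ?_ (norm_nonneg _)
      obtain ⟨hp1, hp2⟩ : (dispersion p - z) / d ∈ I n := hp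
      have h0 : 0 < (dispersion p - z) / d := lt_trans (by positivity) hp1
      have e : |dispersion p - z| = 12 * ((dispersion p - z) / d) := by
        rw [← hd, ← abs_of_pos h0, ← abs_mul, mul_div_cancel₀ _ hd0]
      rw [e]
      exact mul_le_mul_of_nonneg_left hp2.le (by norm_num)
    · rw [h3', h2, Set.indicator_of_notMem (s := dispersion ⁻¹' J n) hp, mul_zero, norm_zero,
        mul_zero, mul_zero]

theorem tendsto_inner_of_orthonormal {E : Type*} [NormedAddCommGroup E] [InnerProductSpace ℂ E]
    {u : ℕ → E} (hu : Orthonormal ℂ u) (v : E) :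
    Filter.Tendsto (fun n => inner ℂ v (u n)) Filter.atTop (nhds 0) := by
  have h := (hu.inner_products_summable v).tendsto_atTop_zero
  rw [tendsto_zero_iff_norm_tendsto_zero]
  have h2 := h.sqrt
  simp only [Real.sqrt_sq (norm_nonneg _), Real.sqrt_zero] at h2
  simpa only [norm_inner_symm] using h2

theorem Icc_subset_essentialSpectrum_restrict {μ₁ μ₂ : ℝ} {K : Submodule ℂ L2}
    (hK : ∀ f ∈ K, hamiltonianL2 μ₁ μ₂ f ∈ K) (hle : evenSymL2 ≤ K) :
    Set.Icc 0 24 ⊆ essentialSpectrum ((hamiltonianL2 μ₁ μ₂).restrict hK) := by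
  intro z hz
  obtain ⟨u, humem, hu, hbound⟩ := exists_orthonormal_shells hz
  have hweak : ∀ {g : Torus3 → ℝ}, Continuous g →
      Filter.Tendsto (fun n => pairing g (u n)) Filter.atTop (nhds 0) := fun {g} hg => by
    simp only [← inner_contL2 hg]
    exact tendsto_inner_of_orthonormal hu _
  refine ⟨fun n => ⟨u n, hle (humem n)⟩, hu.1, fun v => tendsto_inner_of_orthonormal hu (v : L2),
    ?_⟩
  change Filter.Tendsto (fun n => ‖hamiltonianL2 μ₁ μ₂ (u n) - (z : ℂ) • u n‖)
    Filter.atTop (nhds 0)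
  have h1 := tendsto_hamiltonianL2_sub μ₁ μ₂ z (hweak continuous_const)
    fun i => hweak (continuous_cosC_apply i)
  have h2 := (tendsto_one_div_add_atTop_nhds_zero_nat (𝕜 := ℝ)).const_mul 12
  have h3 := h1.add h2
  rw [mul_zero, add_zero] at h3
  refine squeeze_zero (fun n => norm_nonneg _) (fun n => ?_) h3
  have h4 := norm_sub_norm_le (hamiltonianL2 μ₁ μ₂ (u n) - (z : ℂ) • u n)
    (mulDispersionSub z (u n))
  linarith [hbound n]

theorem essentialSpectrum_hamiltonian (μ₁ μ₂ : ℝ) :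
    essentialSpectrum (hamiltonian μ₁ μ₂) = Set.Icc 0 24 := by
  refine Set.Subset.antisymm (essentialSpectrum_restrict_subset _ fun u hu => ⟨?_, fun i => ?_⟩)
    (Icc_subset_essentialSpectrum_restrict _ fun f hf => hf.1)
  · simp only [← inner_contL2 continuous_const]
    exact hu ⟨_, contL2_one_mem_evenSymL2.1⟩
  · simp only [← inner_contL2 (continuous_cosC_apply i)]
    exact hu ⟨_, contL2_cosC_mem_evenL2 i⟩

theorem essentialSpectrum_hamiltonianSym (μ₁ μ₂ : ℝ) :
    essentialSpectrum (hamiltonianSym μ₁ μ₂) = Set.Icc 0 24 := by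
  refine Set.Subset.antisymm (essentialSpectrum_restrict_subset _ fun u hu => ⟨?_, fun i => ?_⟩)
    (Icc_subset_essentialSpectrum_restrict _ le_rfl)
  · simp only [← inner_contL2 continuous_const]
    exact hu ⟨_, contL2_one_mem_evenSymL2⟩
  · simp only [pairing_cosC_of_mem (u _).2, ← inner_contL2 continuous_cosSum]
    simpa using (hu ⟨_, contL2_cosSum_mem_evenSymL2⟩).const_mul (1 / 3 : ℂ)

theorem below_Icc : below (Set.Icc (0 : ℝ) 24) = Set.Iio 0 := by
  ext z
  exact ⟨fun h => h 0 ⟨le_rfl, by norm_num⟩, fun h w hw => lt_of_lt_of_le h hw.1⟩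

theorem above_Icc : above (Set.Icc (0 : ℝ) 24) = Set.Ioi 24 := by
  ext z
  exact ⟨fun h => h 24 ⟨by norm_num, le_rfl⟩, fun h w hw => lt_of_le_of_lt hw.2 h⟩

theorem countBelow_eq {μ₁ μ₂ : ℝ} {ζ : Fin 3} (h : (μ₁, μ₂) ∈ regionMinus ζ) :
    countBelow μ₁ μ₂ = ((ζ : ℕ) : ℕ∞) := by
  obtain ⟨Z, hcard, hZ⟩ := exists_zeros_neg h
  rw [countBelow, essentialSpectrum_hamiltonian, below_Icc, ← hcard]
  exact eigenvalueCount_eq_card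
    (Set.disjoint_left.2 fun z hz hz' => (Set.mem_Iio.1 hz).not_ge hz'.1) hZ

theorem countAbove_eq {μ₁ μ₂ : ℝ} {ζ : Fin 3} (h : (μ₁, μ₂) ∈ regionPlus ζ) :
    countAbove μ₁ μ₂ = ((ζ : ℕ) : ℕ∞) := by
  obtain ⟨Z, hcard, hZ⟩ := exists_zeros_above h
  rw [countAbove, essentialSpectrum_hamiltonian, above_Icc, ← hcard]
  exact eigenvalueCount_eq_card
    (Set.disjoint_left.2 fun z hz hz' => (Set.mem_Ioi.1 hz).not_ge hz'.2) hZ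

end LatticeTwoBoson

end

theorem theorem4p3 (μ₁ μ₂ : ℝ) (ζ : Fin 3) :
    LatticeTwoBoson.essentialSpectrum (LatticeTwoBoson.hamiltonian μ₁ μ₂) = Set.Icc 0 24 ∧
    LatticeTwoBoson.essentialSpectrum (LatticeTwoBoson.hamiltonianSym μ₁ μ₂) = Set.Icc 0 24 ∧
    ((μ₁, μ₂) ∈ LatticeTwoBoson.regionMinus ζ →
      LatticeTwoBoson.countBelow μ₁ μ₂ = ((ζ : ℕ) : ℕ∞) ∧
      (∀ ν₁ ν₂ : ℝ, (ν₁, ν₂) ∈ LatticeTwoBoson.regionMinus ζ →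
        LatticeTwoBoson.countBelow ν₁ ν₂ = LatticeTwoBoson.countBelow μ₁ μ₂)) ∧
    ((μ₁, μ₂) ∈ LatticeTwoBoson.regionPlus ζ →
      LatticeTwoBoson.countAbove μ₁ μ₂ = ((ζ : ℕ) : ℕ∞) ∧
      (∀ ν₁ ν₂ : ℝ, (ν₁, ν₂) ∈ LatticeTwoBoson.regionPlus ζ →
        LatticeTwoBoson.countAbove ν₁ ν₂ = LatticeTwoBoson.countAbove μ₁ μ₂)) ∧
    (∀ z : ℝ, z ∉ LatticeTwoBoson.essentialSpectrum (LatticeTwoBoson.hamiltonian μ₁ μ₂) →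
      Module.End.HasEigenvalue (LatticeTwoBoson.hamiltonianSym μ₁ μ₂) (z : ℂ) →
        LatticeTwoBoson.HasEigenfunctionForm μ₁ μ₂ z) := by
  refine ⟨LatticeTwoBoson.essentialSpectrum_hamiltonian μ₁ μ₂,
    LatticeTwoBoson.essentialSpectrum_hamiltonianSym μ₁ μ₂,
    fun h => ⟨LatticeTwoBoson.countBelow_eq h, fun ν₁ ν₂ hν => ?_⟩,
    fun h => ⟨LatticeTwoBoson.countAbove_eq h, fun ν₁ ν₂ hν => ?_⟩, fun z hz hev => ?_⟩
  · rw [LatticeTwoBoson.countBelow_eq hν, LatticeTwoBoson.countBelow_eq h]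
  · rw [LatticeTwoBoson.countAbove_eq hν, LatticeTwoBoson.countAbove_eq h]
  · rw [LatticeTwoBoson.essentialSpectrum_hamiltonian] at hz
    exact LatticeTwoBoson.hasEigenfunctionForm hz hev
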